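/- Let $\mathbb{N}=\{1,2,\dots\}$, let $\alpha>0$ and $\beta>0$, and let $\xi_y$, $y\in\mathbb{N}^2$, be i.i.d. random variables with the exponential distribution of rate $\alpha$ (mean $1/\alpha$). For $N,M\in\mathbb{N}$ let $G(N,M)$ be the last passage percolation value, i.e. the maximum of $\sum_{j=1}^{N+M-1}\xi_{y_j}$ over all oriented paths $(y_1,\dots,y_{N+M-1})$ from $(1,1)$ to $(N,M)$, that is, paths with $y_{j+1}-y_j\in\{(1,0),(0,1)\}$ for every $j$. Then almost surely $$\lim_{N\to\infty}\frac1N\,G(N,\lfloor\beta N\rfloor)=\frac{(1+\sqrt\beta)^2}{\alpha}.$$ Moreover, for each $\delta>0$ there exists $c=c(\delta)>0$, depending only on $\delta$, $\alpha$ and $\beta$, such that $$P\left\{\left|\frac1N\,G(N,\lfloor\beta N\rfloor)-\frac{(1+\sqrt\beta)^2}{\alpha}\right|>\delta\right\}\le e^{-cN}$$ for all $N\in\mathbb{N}$ with $\lfloor\beta N\rfloor\ge1$. -/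

import Mathlib

open MeasureTheory ProbabilityTheory Filter Topology

/-- One step of an oriented lattice path: exactly one of the two coordinates grows by one. -/
def OrientedStep (y z : ℕ+ × ℕ+) : Prop :=
  z = (y.1 + 1, y.2) ∨ z = (y.1, y.2 + 1)

/-- `l = [y₁, y₂, …]` is an oriented path in `{1, 2, …}²` from `a` to `b`. -/
structure IsOrientedPath (a b : ℕ+ × ℕ+) (l : List (ℕ+ × ℕ+)) : Prop where
  head : l.head? = some a
  last : l.getLast? = some b
  chain : l.IsChain OrientedStep

/-- The values `∑ x_{y_j}` over the oriented paths `(y_j)` from `(1, 1)` to `(N, M)`.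
There is no such path if `N = 0` or `M = 0`. -/
def passageValues (x : ℕ+ × ℕ+ → ℝ) (N M : ℕ) : Set ℝ :=
  {s | ∃ b : ℕ+ × ℕ+, (b.1 : ℕ) = N ∧ (b.2 : ℕ) = M ∧
    ∃ l : List (ℕ+ × ℕ+), IsOrientedPath (1, 1) b l ∧ s = (l.map x).sum}

/-- The last passage percolation value `G(N, M)` of the weights `x`: the largest sum of weights
along an oriented path from `(1, 1)` to `(N, M)`. For `N, M ≥ 1` it is a maximum
(`lastPassage_isGreatest`). -/
noncomputable def lastPassage (x : ℕ+ × ℕ+ → ℝ) (N M : ℕ) : ℝ :=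
  sSup (passageValues x N M)

theorem IsOrientedPath.length_and_mem {b : ℕ+ × ℕ+} :
    ∀ (l : List (ℕ+ × ℕ+)) (a : ℕ+ × ℕ+), IsOrientedPath a b l →
      (l.length + a.1 + a.2 = (b.1 : ℕ) + b.2 + 1) ∧ ∀ y ∈ l, y ≤ b
  | [], a, h => by simpa using h.head
  | [c], a, h => by
      have h1 := h.head
      have h2 := h.last
      simp at h1 h2
      subst h1 h2
      refine ⟨by simp; ring, by simp⟩
  | c :: d :: l, a, h => by
      have h1 := h.head
      simp only [List.head?_cons, Option.some.injEq] at h1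
      subst h1
      have hc := h.chain
      rw [List.isChain_cons_cons] at hc
      have h2 := h.last
      rw [List.getLast?_cons_cons] at h2
      obtain ⟨hl, hm⟩ := IsOrientedPath.length_and_mem (d :: l) d ⟨rfl, h2, hc.2⟩
      have hd : d ≤ b := hm d (by simp)
      refine ⟨?_, ?_⟩
      · rcases hc.1 with rfl | rfl <;> simp at hl ⊢ <;> omega
      · intro y hy
        rcases List.mem_cons.1 hy with rfl | hy
        · refine le_trans ?_ hd
          rcases hc.1 with rfl | rfl
          · exact ⟨(PNat.lt_add_right _ _).le, le_rfl⟩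
          · exact ⟨le_rfl, (PNat.lt_add_right _ _).le⟩
        · exact hm y hy

theorem passageValues_finite (x : ℕ+ × ℕ+ → ℝ) (N M : ℕ) : (passageValues x N M).Finite := by
  by_cases h : ∃ b : ℕ+ × ℕ+, (b.1 : ℕ) = N ∧ (b.2 : ℕ) = M
  · obtain ⟨b, rfl, rfl⟩ := h
    have hf : {l : List (Set.Iic b) | l.length ≤ (b.1 : ℕ) + b.2}.Finite := by
      have : Finite (Set.Iic b) := (Set.finite_Icc (1, 1) b).subset
        (fun y hy => ⟨⟨one_le, one_le⟩, hy⟩)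
      exact List.finite_length_le _ _
    refine (hf.image (fun l => ((l.map Subtype.val).map x).sum)).subset ?_
    rintro s ⟨b', h1, h2, l, hl, rfl⟩
    obtain rfl : b' = b := Prod.ext (PNat.coe_injective h1) (PNat.coe_injective h2)
    obtain ⟨hlen, hm⟩ := IsOrientedPath.length_and_mem l _ hl
    refine ⟨l.attach.map (fun y => ⟨y.1, hm y.1 y.2⟩), ?_, ?_⟩
    · simp at hlen ⊢
      omega
    · simp [Function.comp_def]
  · refine Set.Finite.subset Set.finite_empty ?_
    rintro s ⟨b, h1, h2, -⟩
    exact h ⟨b, h1, h2⟩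

theorem exists_isOrientedPath (b : ℕ+ × ℕ+) : ∃ l, IsOrientedPath (1, 1) b l := by
  have key : ∀ b c, OrientedStep b c → (∃ l, IsOrientedPath (1, 1) b l) →
      ∃ l, IsOrientedPath (1, 1) c l := by
    rintro b c hs ⟨l, hl⟩
    refine ⟨l ++ [c], ?_, by simp, ?_⟩
    · simp [hl.head]
    · refine List.isChain_append.2 ⟨hl.chain, by simp, ?_⟩
      intro y hy z hz
      rw [hl.last] at hy
      simp at hy hz
      subst hy hz
      exact hs
  obtain ⟨m, n⟩ := b
  induction n using PNat.recOn with
  | one =>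
    induction m using PNat.recOn with
    | one => exact ⟨[(1, 1)], rfl, rfl, by simp⟩
    | succ m ih => exact key _ _ (Or.inl rfl) ih
  | succ n ih => exact key _ _ (Or.inr rfl) ih

theorem lastPassage_isGreatest (x : ℕ+ × ℕ+ → ℝ) {N M : ℕ} (hN : 1 ≤ N) (hM : 1 ≤ M) :
    IsGreatest (passageValues x N M) (lastPassage x N M) := by
  have hne : (passageValues x N M).Nonempty := by
    obtain ⟨l, hl⟩ := exists_isOrientedPath (⟨N, hN⟩, ⟨M, hM⟩)
    exact ⟨_, _, rfl, rfl, l, hl, rfl⟩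
  exact ⟨hne.csSup_mem (passageValues_finite x N M),
    fun s hs => le_csSup (passageValues_finite x N M).bddAbove hs⟩

/-!
The limit shape of exponential last passage percolation is obtained by comparison with its
stationary versions. Put i.i.d. exponential weights `z` of rate `α` on `{0, 1, …}²`, multiply those on
the horizontal axis by `s` and those on the vertical axis by `t`, and let `H` be the last passage
value from the origin (`scaledPassage`). For `s = t = 0` this is the value `G` of interest
(`lastPassage_eq_scaledPassage`).

If `1 / s + 1 / t = 1`, the increments of `H` along every row are again i.i.d., with the law they have
on the axis (Burke's property). Here this is deduced from a map on `ℝ³` (`burkeMap`) which preserves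
volume and the density of the three independent exponential variables that meet at one site.
Applied in place, site by site, it preserves the product measure and turns the increments along the
horizontal axis into those along row `m` (`measurePreserving_sweep`, `gridPassage_eq_sum_sweep`).
Hence `H N M` is a sum of two sums of i.i.d. exponential variables, and Chernoff's bound shows that
`H N ⌊β N⌋ / N` is exponentially concentrated at `(s + β t) / α` (`concentratesAt_scaledPassage`).

Upper tail: `G ≤ H`, and for `s = 1 + √β`, `t = 1 + 1 / √β` the mean `(s + β t) / α` takes its minimal
value `(1 + √β)² / α`.

Lower tail: an optimal path for `H` with these parameters leaves the axes either within the first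
`η N` steps, and then `H ≤ G + O(η N)`, or later. In the latter case, raise the factor on the axis by a
small `h`. The path gains at least `h` times the weight of the first `η N` sites of the axis, which is
of order `h η N`, but since the mean is minimal, the passage value of the new stationary model exceeds
that of the old one by `O(h² N)` only. For `h` small this is exponentially unlikely
(`scaledPassage_le_exit`, `concentratesAt_scaledPassage_zero`).

Finally, every deviation event has probability less than `1` (`expField_deviation_lt_one`), so that
the bound can be extended to small `N`, and the almost sure limit follows by the Borel–Cantelli lemma.
-/

/-! ### Passage values with boundary weights -/

/-- The last passage value from `(0, 0)` to `(n, m)` in the quadrant `{0, 1, …}²` with weights `w`,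
defined by its recursion. A path that leaves the axes stays off them, so the weights on the axes act
as a boundary condition for the bulk `{1, 2, …}²`. The weight at the origin is not counted. -/
noncomputable def gridPassage (w : ℕ × ℕ → ℝ) : ℕ → ℕ → ℝ
  | 0, 0 => 0
  | i + 1, 0 => gridPassage w i 0 + w (i + 1, 0)
  | 0, j + 1 => gridPassage w 0 j + w (0, j + 1)
  | i + 1, j + 1 =>
    w (i + 1, j + 1) + max (gridPassage w i (j + 1)) (gridPassage w (i + 1) j)
  termination_by i j => i + j

theorem gridPassage_row_zero (w : ℕ × ℕ → ℝ) (n : ℕ) :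
    gridPassage w n 0 = ∑ i ∈ Finset.range n, w (i + 1, 0) := by
  induction n with
  | zero => simp [gridPassage]
  | succ n ih => rw [gridPassage, ih, Finset.sum_range_succ]

theorem gridPassage_col_zero (w : ℕ × ℕ → ℝ) (m : ℕ) :
    gridPassage w 0 m = ∑ j ∈ Finset.range m, w (0, j + 1) := by
  induction m with
  | zero => simp [gridPassage]
  | succ n ih => rw [gridPassage, ih, Finset.sum_range_succ]

theorem gridPassage_succ_succ (w : ℕ × ℕ → ℝ) (i j : ℕ) :
    gridPassage w (i + 1) (j + 1) =
      w (i + 1, j + 1) + max (gridPassage w i (j + 1)) (gridPassage w (i + 1) j) := by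
  rw [gridPassage]

/-- The passage values are the least solution of the recursion inequalities with given boundary
values. -/
theorem gridPassage_le_of_superharmonic {w : ℕ × ℕ → ℝ} {T : ℕ → ℕ → ℝ}
    (h₁ : ∀ i, gridPassage w i 0 ≤ T i 0) (h₂ : ∀ j, gridPassage w 0 j ≤ T 0 j)
    (h₃ : ∀ i j, w (i + 1, j + 1) + T i (j + 1) ≤ T (i + 1) (j + 1))
    (h₄ : ∀ i j, w (i + 1, j + 1) + T (i + 1) j ≤ T (i + 1) (j + 1)) (n m : ℕ) :
    gridPassage w n m ≤ T n m := by
  induction n generalizing m with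
  | zero => exact h₂ m
  | succ n ihn =>
    induction m with
    | zero => exact h₁ _
    | succ m ihm =>
      rw [gridPassage_succ_succ]
      rcases max_choice (gridPassage w n (m + 1)) (gridPassage w (n + 1) m) with h | h <;> rw [h]
      · linarith [ihn (m + 1), h₃ n m]
      · linarith [h₄ n m]

theorem measurable_gridPassage (n m : ℕ) :
    Measurable fun w : ℕ × ℕ → ℝ => gridPassage w n m := by
  induction n generalizing m with
  | zero => simp only [gridPassage_col_zero]; fun_prop
  | succ n ihn =>
    induction m with
    | zero => simp only [gridPassage_row_zero]; fun_prop
    | succ m ihm =>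
      simp only [gridPassage_succ_succ]
      exact (measurable_pi_apply _).add ((ihn _).max ihm)

/-- The factor `s` on the horizontal axis, `t` on the vertical axis, and `1` in the bulk. (The value
`s` at the origin plays no role.) -/
noncomputable def boundaryFactor (s t : ℝ) (y : ℕ × ℕ) : ℝ :=
  if y.2 = 0 then s else if y.1 = 0 then t else 1

theorem boundaryFactor_pos {s t : ℝ} (hs : 0 < s) (ht : 0 < t) (y : ℕ × ℕ) :
    0 < boundaryFactor s t y := by
  unfold boundaryFactor; split_ifs <;> positivity

/-- The weights obtained from `z` by multiplying those on the horizontal axis by `s` and those on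
the vertical axis by `t`. -/
noncomputable def scaleBoundary (s t : ℝ) (z : ℕ × ℕ → ℝ) (y : ℕ × ℕ) : ℝ :=
  boundaryFactor s t y * z y

@[simp] theorem scaleBoundary_row (s t : ℝ) (z : ℕ × ℕ → ℝ) (i : ℕ) :
    scaleBoundary s t z (i, 0) = s * z (i, 0) := by simp [scaleBoundary, boundaryFactor]

@[simp] theorem scaleBoundary_col (s t : ℝ) (z : ℕ × ℕ → ℝ) (j : ℕ) :
    scaleBoundary s t z (0, j + 1) = t * z (0, j + 1) := by simp [scaleBoundary, boundaryFactor]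

@[simp] theorem scaleBoundary_bulk (s t : ℝ) (z : ℕ × ℕ → ℝ) (i j : ℕ) :
    scaleBoundary s t z (i + 1, j + 1) = z (i + 1, j + 1) := by
  simp [scaleBoundary, boundaryFactor]

theorem measurable_scaleBoundary (s t : ℝ) : Measurable (scaleBoundary s t) := by
  unfold scaleBoundary; fun_prop

/-- The last passage value with weights `z` in the bulk, `s * z` on the horizontal and `t * z` on the
vertical axis. With `s = t = 0` it is the last passage value of the bulk weights alone; with
`1 / s + 1 / t = 1` and i.i.d. exponential `z` it is the stationary model. -/
noncomputable def scaledPassage (s t : ℝ) (z : ℕ × ℕ → ℝ) (n m : ℕ) : ℝ :=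
  gridPassage (scaleBoundary s t z) n m

/-- The sum of the first `n` weights on the horizontal axis, without the origin. -/
def rowSum (z : ℕ × ℕ → ℝ) (n : ℕ) : ℝ := ∑ i ∈ Finset.range n, z (i + 1, 0)

/-- The sum of the first `m` weights on the vertical axis, without the origin. -/
def colSum (z : ℕ × ℕ → ℝ) (m : ℕ) : ℝ := ∑ j ∈ Finset.range m, z (0, j + 1)

theorem scaledPassage_row (s t : ℝ) (z : ℕ × ℕ → ℝ) (n : ℕ) :
    scaledPassage s t z n 0 = s * rowSum z n := by
  simp [scaledPassage, gridPassage_row_zero, rowSum, Finset.mul_sum]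

theorem scaledPassage_col (s t : ℝ) (z : ℕ × ℕ → ℝ) (m : ℕ) :
    scaledPassage s t z 0 m = t * colSum z m := by
  simp [scaledPassage, gridPassage_col_zero, colSum, Finset.mul_sum]

theorem scaledPassage_succ_succ (s t : ℝ) (z : ℕ × ℕ → ℝ) (i j : ℕ) :
    scaledPassage s t z (i + 1) (j + 1) = z (i + 1, j + 1) +
      max (scaledPassage s t z i (j + 1)) (scaledPassage s t z (i + 1) j) := by
  simp [scaledPassage, gridPassage_succ_succ]

theorem measurable_scaledPassage (s t : ℝ) (n m : ℕ) :
    Measurable fun z : ℕ × ℕ → ℝ => scaledPassage s t z n m :=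
  (measurable_gridPassage n m).comp (measurable_scaleBoundary s t)

theorem measurable_rowSum (n : ℕ) : Measurable fun z : ℕ × ℕ → ℝ => rowSum z n := by
  unfold rowSum; fun_prop

theorem measurable_colSum (n : ℕ) : Measurable fun z : ℕ × ℕ → ℝ => colSum z n := by
  unfold colSum; fun_prop

theorem monotone_rowSum {z : ℕ × ℕ → ℝ} (hz : ∀ y, 0 ≤ z y) : Monotone (rowSum z) :=
  monotone_nat_of_le_succ fun n => by
    simp only [rowSum, Finset.sum_range_succ]; linarith [hz (n + 1, 0)]

theorem monotone_colSum {z : ℕ × ℕ → ℝ} (hz : ∀ y, 0 ≤ z y) : Monotone (colSum z) :=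
  monotone_nat_of_le_succ fun n => by
    simp only [colSum, Finset.sum_range_succ]; linarith [hz (0, n + 1)]

theorem rowSum_nonneg {z : ℕ × ℕ → ℝ} (hz : ∀ y, 0 ≤ z y) (n : ℕ) : 0 ≤ rowSum z n :=
  Finset.sum_nonneg fun _ _ => hz _

theorem colSum_nonneg {z : ℕ × ℕ → ℝ} (hz : ∀ y, 0 ≤ z y) (n : ℕ) : 0 ≤ colSum z n :=
  Finset.sum_nonneg fun _ _ => hz _

theorem scaledPassage_le_of_superharmonic {s t : ℝ} {z : ℕ × ℕ → ℝ} {T : ℕ → ℕ → ℝ}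
    (h₁ : ∀ i, s * rowSum z i ≤ T i 0) (h₂ : ∀ j, t * colSum z j ≤ T 0 j)
    (h₃ : ∀ i j, z (i + 1, j + 1) + T i (j + 1) ≤ T (i + 1) (j + 1))
    (h₄ : ∀ i j, z (i + 1, j + 1) + T (i + 1) j ≤ T (i + 1) (j + 1)) (n m : ℕ) :
    scaledPassage s t z n m ≤ T n m :=
  gridPassage_le_of_superharmonic (fun i => (scaledPassage_row s t z i).trans_le (h₁ i))
    (fun j => (scaledPassage_col s t z j).trans_le (h₂ j)) (by simpa using h₃) (by simpa using h₄)
    n m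

theorem scaledPassage_step_left (s t : ℝ) (z : ℕ × ℕ → ℝ) (i j : ℕ) :
    z (i + 1, j + 1) + scaledPassage s t z i (j + 1) ≤ scaledPassage s t z (i + 1) (j + 1) := by
  rw [scaledPassage_succ_succ]; gcongr; exact le_max_left _ _

theorem scaledPassage_step_down (s t : ℝ) (z : ℕ × ℕ → ℝ) (i j : ℕ) :
    z (i + 1, j + 1) + scaledPassage s t z (i + 1) j ≤ scaledPassage s t z (i + 1) (j + 1) := by
  rw [scaledPassage_succ_succ]; gcongr; exact le_max_right _ _

theorem scaledPassage_mono {s s' t t' : ℝ} (hs : s ≤ s') (ht : t ≤ t') {z : ℕ × ℕ → ℝ}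
    (hz : ∀ y, 0 ≤ z y) (n m : ℕ) : scaledPassage s t z n m ≤ scaledPassage s' t' z n m :=
  scaledPassage_le_of_superharmonic
    (fun i => by
      rw [scaledPassage_row]; exact mul_le_mul_of_nonneg_right hs (rowSum_nonneg hz i))
    (fun j => by
      rw [scaledPassage_col]; exact mul_le_mul_of_nonneg_right ht (colSum_nonneg hz j))
    (scaledPassage_step_left _ _ z) (scaledPassage_step_down _ _ z) n m

theorem scaledPassage_nonneg {s t : ℝ} (hs : 0 ≤ s) (ht : 0 ≤ t) {z : ℕ × ℕ → ℝ}
    (hz : ∀ y, 0 ≤ z y) (n m : ℕ) : 0 ≤ scaledPassage s t z n m := by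
  induction n generalizing m with
  | zero => rw [scaledPassage_col]; exact mul_nonneg ht (colSum_nonneg hz m)
  | succ n ihn =>
    cases m with
    | zero => rw [scaledPassage_row]; exact mul_nonneg hs (rowSum_nonneg hz _)
    | succ m =>
      linarith [scaledPassage_step_left s t z n m, ihn (m + 1), hz (n + 1, m + 1)]

/-- A maximizing path leaves the axis either within the first `k` steps, when it earns at most the
weight of these steps plus the bulk passage value, or later, when it gains at least `s₁ - s` times
that weight if the factor on the axis is raised from `s` to `s₁`. -/
theorem scaledPassage_le_exit {s t s₁ t₁ s₂ t₂ : ℝ} (hs : 0 ≤ s) (ht : 0 ≤ t) (hs₁ : s ≤ s₁)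
    (ht₂ : t ≤ t₂) {z : ℕ × ℕ → ℝ} (hz : ∀ y, 0 ≤ z y) (k n m : ℕ) :
    scaledPassage s t z n m ≤ max
      (max (s * rowSum z k + scaledPassage 0 0 z n m)
        (scaledPassage s₁ t₁ z n m - (s₁ - s) * rowSum z k))
      (max (t * colSum z k + scaledPassage 0 0 z n m)
        (scaledPassage s₂ t₂ z n m - (t₂ - t) * colSum z k)) := by
  refine scaledPassage_le_of_superharmonic (T := fun n m => max
      (max (s * rowSum z k + scaledPassage 0 0 z n m)
        (scaledPassage s₁ t₁ z n m - (s₁ - s) * rowSum z k))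
      (max (t * colSum z k + scaledPassage 0 0 z n m)
        (scaledPassage s₂ t₂ z n m - (t₂ - t) * colSum z k))) ?_ ?_ ?_ ?_ n m
  · intro i
    refine le_max_of_le_left ?_
    simp only [scaledPassage_row, zero_mul, add_zero]
    rcases le_total i k with h | h
    · exact le_max_of_le_left (mul_le_mul_of_nonneg_left (monotone_rowSum hz h) hs)
    · refine le_max_of_le_right ?_
      linarith [mul_le_mul_of_nonneg_left (monotone_rowSum hz h) (sub_nonneg.2 hs₁)]
  · intro i
    refine le_max_of_le_right ?_
    simp only [scaledPassage_col, zero_mul, add_zero]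
    rcases le_total i k with h | h
    · exact le_max_of_le_left (mul_le_mul_of_nonneg_left (monotone_colSum hz h) ht)
    · refine le_max_of_le_right ?_
      linarith [mul_le_mul_of_nonneg_left (monotone_colSum hz h) (sub_nonneg.2 ht₂)]
  · intro i j
    simp only [← max_add_add_left]
    refine max_le_max (max_le_max ?_ ?_) (max_le_max ?_ ?_)
    · linarith [scaledPassage_step_left 0 0 z i j]
    · linarith [scaledPassage_step_left s₁ t₁ z i j]
    · linarith [scaledPassage_step_left 0 0 z i j]
    · linarith [scaledPassage_step_left s₂ t₂ z i j]
  · intro i j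
    simp only [← max_add_add_left]
    refine max_le_max (max_le_max ?_ ?_) (max_le_max ?_ ?_)
    · linarith [scaledPassage_step_down 0 0 z i j]
    · linarith [scaledPassage_step_down s₁ t₁ z i j]
    · linarith [scaledPassage_step_down 0 0 z i j]
    · linarith [scaledPassage_step_down s₂ t₂ z i j]

/-! ### Comparison with oriented paths -/

theorem IsOrientedPath.sum_le_scaledPassage {z : ℕ × ℕ → ℝ} (l : List (ℕ+ × ℕ+)) :
    ∀ b, IsOrientedPath (1, 1) b l →
      (l.map fun y => z (y.1, y.2)).sum ≤ scaledPassage 0 0 z b.1 b.2 := by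
  have hstep : ∀ b : ℕ+ × ℕ+, ∃ i j : ℕ, (b.1 : ℕ) = i + 1 ∧ (b.2 : ℕ) = j + 1 := fun b =>
    ⟨b.1.natPred, b.2.natPred, b.1.natPred_add_one.symm, b.2.natPred_add_one.symm⟩
  induction l using List.reverseRecOn with
  | nil => intro b h; simpa using h.head
  | append_singleton l c ih =>
    intro b h
    have hb := h.last
    simp only [List.getLast?_append, List.getLast?_singleton, Option.some_or,
      Option.some.injEq] at hb
    subst hb
    rcases List.eq_nil_or_concat l with rfl | ⟨l', d, rfl⟩
    · have hc := h.head
      simp only [List.nil_append, List.head?_cons, Option.some.injEq] at hc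
      subst hc
      have := scaledPassage_step_left 0 0 z 0 0
      simpa [scaledPassage_col] using this
    · have hchain := List.isChain_append.1 h.chain
      have hd : IsOrientedPath (1, 1) d (l' ++ [d]) := by
        refine ⟨?_, by simp, by simpa using hchain.1⟩
        have := h.head
        cases l' <;> simpa using this
      have hs : OrientedStep d c := hchain.2.2 d (by simp) c (by simp)
      have hi := ih d (by simpa using hd)
      obtain ⟨i, j, hi', hj'⟩ := hstep d
      rw [List.map_append, List.sum_append]
      rw [hi', hj'] at hi
      rcases hs with rfl | rfl
      · have := scaledPassage_step_left 0 0 z (i + 1) j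
        simp [hi', hj'] at hi ⊢
        linarith
      · have := scaledPassage_step_down 0 0 z i (j + 1)
        simp [hi', hj'] at hi ⊢
        linarith

/-- Nonnegativity of the weights is needed because the recursion lets a path start on an axis, where it
collects `0`. -/
theorem exists_scaledPassage_le_sum {z : ℕ × ℕ → ℝ} (hz : ∀ y, 0 ≤ z y) (i j : ℕ) :
    ∃ l, IsOrientedPath (1, 1) (i.succPNat, j.succPNat) l ∧
      scaledPassage 0 0 z (i + 1) (j + 1) ≤ (l.map fun y => z (y.1, y.2)).sum := by
  have extend : ∀ (b c : ℕ+ × ℕ+) (x y : ℝ), OrientedStep b c →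
      (∃ l, IsOrientedPath (1, 1) b l ∧ x ≤ (l.map fun y => z (y.1, y.2)).sum) →
      y ≤ z (c.1, c.2) + x →
      ∃ l, IsOrientedPath (1, 1) c l ∧ y ≤ (l.map fun y => z (y.1, y.2)).sum := by
    rintro b c x y hs ⟨l, hl, hx⟩ hy
    refine ⟨l ++ [c], ⟨by simp [hl.head], by simp, ?_⟩, by simp; linarith⟩
    refine List.isChain_append.2 ⟨hl.chain, by simp, ?_⟩
    intro y hy z hz
    rw [hl.last] at hy
    simp at hy hz
    subst hy hz
    exact hs
  have h0 : ∀ n, scaledPassage 0 0 z 0 n = 0 := fun n => by simp [scaledPassage_col]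
  have h0' : ∀ n, scaledPassage 0 0 z n 0 = 0 := fun n => by simp [scaledPassage_row]
  induction i generalizing j with
  | zero =>
    induction j with
    | zero =>
      refine ⟨[(1, 1)], ⟨rfl, rfl, by simp⟩, ?_⟩
      simp [scaledPassage_succ_succ, h0, h0']
    | succ j ihj =>
      refine extend _ _ _ _ (Or.inr rfl) ihj ?_
      rw [scaledPassage_succ_succ, h0, max_eq_right (scaledPassage_nonneg le_rfl le_rfl hz _ _)]
      simp
  | succ i ihi =>
    induction j with
    | zero =>
      refine extend _ _ _ _ (Or.inl rfl) (ihi 0) ?_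
      rw [scaledPassage_succ_succ, h0', max_eq_left (scaledPassage_nonneg le_rfl le_rfl hz _ _)]
      simp
    | succ j ihj =>
      rw [scaledPassage_succ_succ]
      rcases max_choice (scaledPassage 0 0 z (i + 1) (j + 1 + 1))
        (scaledPassage 0 0 z (i + 1 + 1) (j + 1)) with h | h <;> rw [h]
      · exact extend _ _ _ _ (Or.inl rfl) (ihi (j + 1)) (by simp)
      · exact extend _ _ _ _ (Or.inr rfl) ihj (by simp)

theorem lastPassage_eq_scaledPassage {z : ℕ × ℕ → ℝ} (hz : ∀ y, 0 ≤ z y) {N M : ℕ}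
    (hN : 1 ≤ N) (hM : 1 ≤ M) :
    lastPassage (fun y => z (y.1, y.2)) N M = scaledPassage 0 0 z N M := by
  have h := lastPassage_isGreatest (fun y => z (y.1, y.2)) hN hM
  refine le_antisymm ?_ ?_
  · obtain ⟨b, rfl, rfl, l, hl, hs⟩ := h.1
    rw [hs]
    exact hl.sum_le_scaledPassage l b
  · obtain ⟨i, rfl⟩ := Nat.exists_eq_add_of_le' hN
    obtain ⟨j, rfl⟩ := Nat.exists_eq_add_of_le' hM
    obtain ⟨l, hl, hle⟩ := exists_scaledPassage_le_sum hz i j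
    exact hle.trans (h.2 ⟨_, rfl, rfl, l, hl, rfl⟩)

/-! ### Burke's property at one site -/

/-- The local move of the stationary model. From the horizontal increment below a site, the vertical
increment to its left and its weight, in the order `((I, J), x)`, it produces the horizontal
increment above and the vertical increment to the right, `x + (I - J)⁺` and `x + (J - I)⁺`, and in
place of the weight `min I J`, which makes the map volume preserving. -/
noncomputable def burkeMap (p : (ℝ × ℝ) × ℝ) : (ℝ × ℝ) × ℝ :=
  ((p.2 + max (p.1.1 - p.1.2) 0, p.2 + max (p.1.2 - p.1.1) 0), min p.1.1 p.1.2)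

theorem measurePreserving_shear {φ : ℝ → ℝ} (hφ : Measurable φ) :
    MeasurePreserving (fun p : ℝ × ℝ => (p.1, φ p.1 + p.2)) :=
  (MeasurePreserving.id volume).skew_product (g := fun x y => φ x + y) (by fun_prop)
    (ae_of_all _ fun x => (measurePreserving_add_left volume (φ x)).map_eq)

/-- In the coordinates `(I - J, min I J, x)`, which are reached by shears, the map exchanges the last
two coordinates. -/
theorem volume_preserving_burkeMap : MeasurePreserving burkeMap := by
  have hswap : MeasurePreserving (Prod.swap : ℝ × ℝ → ℝ × ℝ) := Measure.measurePreserving_swap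
  have hA : MeasurePreserving fun p : ℝ × ℝ => (p.1 - p.2, min p.1 p.2) := by
    convert! (measurePreserving_shear (φ := fun x => min x 0) (by fun_prop)).comp
      (hswap.comp ((measurePreserving_shear (φ := fun x => -x) (by fun_prop)).comp hswap))
      using 1
    ext ⟨x, y⟩
    · simp; ring
    · simp; grind
  have hB : MeasurePreserving fun p : ℝ × ℝ => (p.2 + max p.1 0, p.2 + max (-p.1) 0) := by
    convert! hswap.comp ((measurePreserving_shear (φ := fun x => x) (by fun_prop)).comp
      (hswap.comp (measurePreserving_shear (φ := fun x => max (-x) 0) (by fun_prop))))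
      using 1
    ext ⟨x, y⟩
    · simp; grind
    · simp; grind
  have hσ : MeasurePreserving fun p : (ℝ × ℝ) × ℝ => ((p.1.1, p.2), p.1.2) :=
    (volume_preserving_prodAssoc (α₁ := ℝ) (β₁ := ℝ) (γ₁ := ℝ)).symm.comp
      (((MeasurePreserving.id volume).prod hswap).comp
        (volume_preserving_prodAssoc (α₁ := ℝ) (β₁ := ℝ) (γ₁ := ℝ)))
  convert! (hB.prod (MeasurePreserving.id volume)).comp
    (hσ.comp (hA.prod (MeasurePreserving.id volume))) using 1
  ext ⟨⟨x, y⟩, z⟩ <;> simp [burkeMap]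

theorem MeasureTheory.MeasurePreserving.withDensity_of_comp_eq {X : Type*} [MeasurableSpace X]
    {μ : Measure X} {T : X → X} (hT : MeasurePreserving T μ μ) {g : X → ENNReal}
    (hg : Measurable g) (h : ∀ x, g (T x) = g x) :
    MeasurePreserving T (μ.withDensity g) (μ.withDensity g) := by
  refine ⟨hT.measurable, Measure.ext fun s hs => ?_⟩
  rw [Measure.map_apply hT.measurable hs, withDensity_apply _ (hT.measurable hs),
    withDensity_apply _ hs, ← hT.setLIntegral_comp_preimage hs hg]
  simp only [h]

theorem expMeasure_eq_withDensity (r : ℝ) :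
    expMeasure r = volume.withDensity (exponentialPDF r) := rfl

theorem measurable_exponentialPDF (r : ℝ) : Measurable (exponentialPDF r) :=
  (measurable_exponentialPDFReal r).ennreal_ofReal

/-- Burke's property for one site. The map preserves volume, and the joint density as well, because
`p I + q J + (p + q) x` is the same before and after. -/
theorem measurePreserving_burkeMap {p q : ℝ} (hp : 0 < p) (hq : 0 < q) :
    MeasurePreserving burkeMap
      (((expMeasure p).prod (expMeasure q)).prod (expMeasure (p + q)))
      (((expMeasure p).prod (expMeasure q)).prod (expMeasure (p + q))) := by
  have hp' := measurable_exponentialPDF p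
  have hq' := measurable_exponentialPDF q
  have hpq' := measurable_exponentialPDF (p + q)
  have h2 : Measurable fun z : ℝ × ℝ => exponentialPDF p z.1 * exponentialPDF q z.2 := by fun_prop
  have : SigmaFinite (volume.withDensity (exponentialPDF (p + q))) := by
    have := isProbabilityMeasure_expMeasure (add_pos hp hq)
    rw [expMeasure_eq_withDensity] at this
    infer_instance
  have : SigmaFinite (volume.withDensity (exponentialPDF q)) := by
    have := isProbabilityMeasure_expMeasure hq
    rw [expMeasure_eq_withDensity] at this
    infer_instance
  simp only [expMeasure_eq_withDensity]
  rw [prod_withDensity hp' hq', prod_withDensity h2 hpq']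
  refine volume_preserving_burkeMap.withDensity_of_comp_eq (by fun_prop) ?_
  rintro ⟨⟨x, y⟩, z⟩
  have key : ∀ x y z : ℝ, exponentialPDF p x * exponentialPDF q y * exponentialPDF (p + q) z =
      if 0 ≤ x ∧ 0 ≤ y ∧ 0 ≤ z then
        ENNReal.ofReal (p * q * (p + q) * Real.exp (-(p * x + q * y + (p + q) * z))) else 0 := by
    intro x y z
    split_ifs with h
    · rw [exponentialPDF_of_nonneg h.1, exponentialPDF_of_nonneg h.2.1,
        exponentialPDF_of_nonneg h.2.2, ← ENNReal.ofReal_mul (by positivity),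
        ← ENNReal.ofReal_mul (by positivity)]
      congr 1
      rw [neg_add, neg_add, Real.exp_add, Real.exp_add]
      ring
    · by_cases hx : 0 ≤ x
      · by_cases hy : 0 ≤ y
        · rw [exponentialPDF_of_neg (x := z) (by grind), mul_zero]
        · rw [exponentialPDF_of_neg (x := y) (by grind), mul_zero, zero_mul]
      · rw [exponentialPDF_of_neg (x := x) (by grind), zero_mul, zero_mul]
  simp only [burkeMap]
  rw [key, key]
  have hiff : (0 ≤ z + max (x - y) 0 ∧ 0 ≤ z + max (y - x) 0 ∧ 0 ≤ min x y) ↔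
      0 ≤ x ∧ 0 ≤ y ∧ 0 ≤ z := by grind
  rw [if_congr hiff rfl rfl]
  congr 4
  rcases le_total x y with h | h
  · rw [max_eq_right (by linarith), max_eq_left (by linarith), min_eq_left h]; ring
  · rw [max_eq_left (by linarith), max_eq_right (by linarith), min_eq_right h]; ring

/-! ### The stationary model -/

/-- A product measure is preserved by a map that acts on three coordinates only and preserves their
joint law. -/
theorem measurePreserving_update₃ {ι : Type*} [DecidableEq ι] (μ : ι → Measure ℝ)
    [∀ i, IsProbabilityMeasure (μ i)] {T : (ℝ × ℝ) × ℝ → (ℝ × ℝ) × ℝ} {i j k : ι} (hij : i ≠ j)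
    (hik : i ≠ k) (hjk : j ≠ k)
    (hT : MeasurePreserving T (((μ i).prod (μ j)).prod (μ k)) (((μ i).prod (μ j)).prod (μ k))) :
    MeasurePreserving (fun w : ι → ℝ => Function.update (Function.update (Function.update w
        i (T ((w i, w j), w k)).1.1) j (T ((w i, w j), w k)).1.2) k (T ((w i, w j), w k)).2)
      (Measure.infinitePi μ) (Measure.infinitePi μ) := by
  set Ψ := fun w : ι → ℝ => Function.update (Function.update (Function.update w
        i (T ((w i, w j), w k)).1.1) j (T ((w i, w j), w k)).1.2) k (T ((w i, w j), w k)).2 with hΨ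
  have hTm := hT.measurable
  have hm : ∀ x, Measurable fun w : ι → ℝ => w x := fun x => measurable_pi_apply x
  have hΨm : Measurable Ψ := by
    refine measurable_pi_lambda _ fun x => ?_
    simp only [hΨ, Function.update_apply]
    split_ifs <;> fun_prop
  have hind : iIndepFun (fun (x : ι) (w : ι → ℝ) => w x) (Measure.infinitePi μ) :=
    iIndepFun_infinitePi (X := fun _ x => x) (fun _ => measurable_id)
  have hπm : Measurable fun w : ι → ℝ => ((w i, w j), w k) := by fun_prop
  have hlaw : Measure.map (fun w : ι → ℝ => ((w i, w j), w k)) (Measure.infinitePi μ) =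
      ((μ i).prod (μ j)).prod (μ k) := by
    rw [(indepFun_iff_map_prod_eq_prod_map_map (by fun_prop) (hm k).aemeasurable).1
      (hind.indepFun_prodMk hm i j k hik hjk),
      (indepFun_iff_map_prod_eq_prod_map_map (hm i).aemeasurable
        (hm j).aemeasurable).1 (hind.indepFun hij)]
    simp only [Measure.infinitePi_map_eval]
  refine ⟨hΨm, Measure.eq_infinitePi _ fun s t ht => ?_⟩
  rw [Measure.map_apply hΨm (MeasurableSet.pi s.countable_toSet fun x _ => ht x),
    ← Measure.infinitePi_pi μ fun x _ => ht x]
  -- A box with sides `t` in the directions `s` is a box with sides `t'` in the directions `i`, `j`, `k`,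
  -- intersected with an event that does not involve these three coordinates.
  set t' : ι → Set ℝ := fun x => if x ∈ s then t x else Set.univ with ht'
  have ht'm : ∀ x, MeasurableSet (t' x) := fun x => by
    simp only [ht']; split_ifs; exacts [ht x, MeasurableSet.univ]
  set A : Set ((ℝ × ℝ) × ℝ) := (t' i ×ˢ t' j) ×ˢ t' k
  have hA : MeasurableSet A := ((ht'm i).prod (ht'm j)).prod (ht'm k)
  set S' : Finset ι := s \ {i, j, k}
  have hpi : ∀ v : ι → ℝ, v ∈ (s : Set ι).pi t ↔
      ((v i, v j), v k) ∈ A ∧ v ∈ (S' : Set ι).pi t := by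
    intro v
    simp only [Set.mem_pi, A, Set.mem_prod, ht', S']
    grind
  have hdisj : Disjoint ({i, j, k} : Finset ι) S' := Finset.disjoint_sdiff
  have hind2 := hind.indepFun_finset _ _ hdisj hm
  have hsplit : ∀ B : Set ((ℝ × ℝ) × ℝ), MeasurableSet B →
      Measure.infinitePi μ ((fun w : ι → ℝ => ((w i, w j), w k)) ⁻¹' B ∩ (S' : Set ι).pi t) =
      ((μ i).prod (μ j)).prod (μ k) B * Measure.infinitePi μ ((S' : Set ι).pi t) := by
    intro B hB
    have h := hind2.measure_inter_preimage_eq_mul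
      ((fun v : ({i, j, k} : Finset ι) → ℝ => ((v ⟨i, by simp⟩, v ⟨j, by simp⟩), v ⟨k, by simp⟩))
        ⁻¹' B) (Set.univ.pi fun x : S' => t x) ((by fun_prop : Measurable _) hB)
      (MeasurableSet.univ_pi fun x => ht x)
    have hC : (fun (a : ι → ℝ) (i : S') => a i) ⁻¹' (Set.univ.pi fun x : S' => t x) =
        (S' : Set ι).pi t := by ext v; simp
    rw [hC] at h
    rw [← hlaw, Measure.map_apply hπm hB]
    exact h
  have h1 : Ψ ⁻¹' (s : Set ι).pi t =
      (fun w : ι → ℝ => ((w i, w j), w k)) ⁻¹' (T ⁻¹' A) ∩ (S' : Set ι).pi t := by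
    ext w
    have hC : Ψ w ∈ (S' : Set ι).pi t ↔ w ∈ (S' : Set ι).pi t := by
      simp only [Set.mem_pi]
      refine forall₂_congr fun x hx => ?_
      have hx' : x ≠ i ∧ x ≠ j ∧ x ≠ k := by simp [S'] at hx; tauto
      simp [hΨ, Function.update_of_ne, hx'.1, hx'.2.1, hx'.2.2]
    have hTw : ((Ψ w i, Ψ w j), Ψ w k) = T ((w i, w j), w k) := by
      simp [hΨ, hij, hik, hjk]
    rw [Set.mem_preimage, hpi, hC, hTw]
    rfl
  have h2 : (s : Set ι).pi t =
      (fun w : ι → ℝ => ((w i, w j), w k)) ⁻¹' A ∩ (S' : Set ι).pi t := by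
    ext w
    exact hpi w
  rw [h1, hsplit _ (hTm hA), hT.measure_preimage hA.nullMeasurableSet, ← hsplit _ hA, ← h2]

/-- The local move at the site `(k + 1, m + 1)`, performed in place: the coordinate `(k + 1, 0)` holds
the current horizontal increment in column `k + 1`, and `(0, m + 1)` the current vertical increment
in row `m + 1`. -/
noncomputable def burkeStep (k m : ℕ) (w : ℕ × ℕ → ℝ) : ℕ × ℕ → ℝ :=
  Function.update (Function.update (Function.update w
    (k + 1, 0) (burkeMap ((w (k + 1, 0), w (0, m + 1)), w (k + 1, m + 1))).1.1)
    (0, m + 1) (burkeMap ((w (k + 1, 0), w (0, m + 1)), w (k + 1, m + 1))).1.2)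
    (k + 1, m + 1) (burkeMap ((w (k + 1, 0), w (0, m + 1)), w (k + 1, m + 1))).2

/-- The local moves at the first `k` bulk sites of row `m + 1`, from left to right. -/
noncomputable def rowSweep (m : ℕ) : ℕ → (ℕ × ℕ → ℝ) → ℕ × ℕ → ℝ
  | 0, w => w
  | k + 1, w => burkeStep k m (rowSweep m k w)

/-- The local moves at the first `n` bulk sites of each of the first `m` rows, row by row. -/
noncomputable def sweep (n : ℕ) : ℕ → (ℕ × ℕ → ℝ) → ℕ × ℕ → ℝ
  | 0, w => w
  | m + 1, w => rowSweep m n (sweep n m w)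

/-- If `h` and `h'` are the passage values along two consecutive rows, the sweep of the upper row turns
the increments of `h` into those of `h'`. -/
theorem rowSweep_spec {m n : ℕ} {w : ℕ × ℕ → ℝ} {h h' : ℕ → ℝ}
    (hrow : ∀ i < n, w (i + 1, 0) = h (i + 1) - h i) (hcol : w (0, m + 1) = h' 0 - h 0)
    (hbulk : ∀ i < n, h' (i + 1) = w (i + 1, m + 1) + max (h' i) (h (i + 1))) (k : ℕ)
    (hk : k ≤ n) :
    (∀ i < k, rowSweep m k w (i + 1, 0) = h' (i + 1) - h' i) ∧
      (∀ i, k ≤ i → rowSweep m k w (i + 1, 0) = w (i + 1, 0)) ∧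
      rowSweep m k w (0, m + 1) = h' k - h k ∧
      (∀ i, k ≤ i → rowSweep m k w (i + 1, m + 1) = w (i + 1, m + 1)) ∧
      ∀ i j, j ≠ m → rowSweep m k w (i, j + 1) = w (i, j + 1) := by
  induction k with
  | zero => simp [rowSweep, hcol]
  | succ k ih =>
    obtain ⟨h1, h2, h3, h4, h5⟩ := ih (by omega)
    have hb := hbulk k (by omega)
    have hr := hrow k (by omega)
    refine ⟨fun i hi => ?_, fun i hi => ?_, ?_, fun i hi => ?_, fun i j hj => ?_⟩
    · rcases Nat.lt_succ_iff_lt_or_eq.1 hi with hi | rfl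
      · have := h1 i hi
        simpa [rowSweep, burkeStep, Function.update_apply, hi.ne] using this
      · simp [rowSweep, burkeStep, burkeMap, h2, h3, h4]
        grind
    · have := h2 i (by omega)
      have hne : i ≠ k := by omega
      simpa [rowSweep, burkeStep, Function.update_apply, hne] using this
    · simp [rowSweep, burkeStep, burkeMap, h2, h3, h4]
      grind
    · have := h4 i (by omega)
      have hne : i ≠ k := by omega
      simpa [rowSweep, burkeStep, Function.update_apply, hne] using this
    · have := h5 i j hj
      simpa [rowSweep, burkeStep, Function.update_apply, hj] using this

theorem sweep_spec (w : ℕ × ℕ → ℝ) (n m : ℕ) :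
    (∀ i < n, sweep n m w (i + 1, 0) = gridPassage w (i + 1) m - gridPassage w i m) ∧
      ∀ i j, m ≤ j → sweep n m w (i, j + 1) = w (i, j + 1) := by
  induction m with
  | zero => simp [sweep, gridPassage_row_zero, Finset.sum_range_succ]
  | succ m ih =>
    have hcol : sweep n m w (0, m + 1) = gridPassage w 0 (m + 1) - gridPassage w 0 m := by
      rw [ih.2 0 m le_rfl, gridPassage_col_zero, gridPassage_col_zero, Finset.sum_range_succ]
      ring
    obtain ⟨h1, -, -, -, h5⟩ := rowSweep_spec (h := fun i => gridPassage w i m)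
      (h' := fun i => gridPassage w i (m + 1)) ih.1 hcol
      (fun i _ => by rw [ih.2 _ m le_rfl, gridPassage_succ_succ]) n le_rfl
    refine ⟨h1, fun i j hj => ?_⟩
    rw [sweep, h5 i j (by omega), ih.2 i j (by omega)]

/-- The passage value is the sum of the increments up the vertical axis and then along the row `m`. -/
theorem gridPassage_eq_sum_sweep (w : ℕ × ℕ → ℝ) (n m : ℕ) :
    gridPassage w n m = colSum w m + rowSum (sweep n m w) n := by
  have h : rowSum (sweep n m w) n =
      ∑ i ∈ Finset.range n, (gridPassage w (i + 1) m - gridPassage w i m) :=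
    Finset.sum_congr rfl fun i hi => (sweep_spec w n m).1 i (Finset.mem_range.1 hi)
  rw [h, Finset.sum_range_sub (fun i => gridPassage w i m), gridPassage_col_zero, colSum]
  ring

theorem map_mul_expMeasure {r s : ℝ} (hr : 0 < r) (hs : 0 < s) :
    (expMeasure r).map (fun x => s * x) = expMeasure (r / s) := by
  have := isProbabilityMeasure_expMeasure hr
  have := isProbabilityMeasure_expMeasure (div_pos hr hs)
  have hm : Measurable fun x : ℝ => s * x := measurable_const_mul s
  have : IsProbabilityMeasure ((expMeasure r).map (fun x => s * x)) :=
    Measure.isProbabilityMeasure_map hm.aemeasurable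
  refine Measure.eq_of_cdf _ _ ?_
  ext x
  rw [cdf_expMeasure_eq (div_pos hr hs), cdf_eq_real, map_measureReal_apply hm measurableSet_Iic]
  have : (fun x : ℝ => s * x) ⁻¹' Set.Iic x = Set.Iic (x / s) := by
    ext y
    simp [le_div_iff₀ hs, mul_comm]
  rw [this, ← cdf_eq_real, cdf_expMeasure_eq hr]
  simp only [le_div_iff₀ hs, zero_mul]
  congr 4
  field_simp

/-- The law of independent exponential variables of rate `α` indexed by `ℕ × ℕ`. -/
noncomputable def expField (α : ℝ) : Measure (ℕ × ℕ → ℝ) :=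
  Measure.infinitePi fun _ => expMeasure α

theorem map_scaleBoundary_expField {α s t : ℝ} (hα : 0 < α) (hs : 0 < s) (ht : 0 < t) :
    (expField α).map (scaleBoundary s t) =
      Measure.infinitePi fun y => expMeasure (α / boundaryFactor s t y) := by
  have := isProbabilityMeasure_expMeasure hα
  have h := Measure.infinitePi_map_pi (fun _ : ℕ × ℕ => expMeasure α)
    (f := fun y x => boundaryFactor s t y * x) (fun y => measurable_const_mul _)
  have hpos := boundaryFactor_pos hs ht
  simp only [map_mul_expMeasure hα (hpos _)] at h
  exact h

theorem measurePreserving_sweep {α s t : ℝ} (hα : 0 < α) (hs : 0 < s) (ht : 0 < t)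
    (hst : 1 / s + 1 / t = 1) (n m : ℕ) :
    MeasurePreserving (sweep n m) ((expField α).map (scaleBoundary s t))
      ((expField α).map (scaleBoundary s t)) := by
  rw [map_scaleBoundary_expField hα hs ht]
  have hpos := boundaryFactor_pos hs ht
  have : ∀ y, IsProbabilityMeasure (expMeasure (α / boundaryFactor s t y)) := fun y =>
    isProbabilityMeasure_expMeasure (div_pos hα (hpos y))
  have hstep : ∀ k m, MeasurePreserving (burkeStep k m)
      (Measure.infinitePi fun y => expMeasure (α / boundaryFactor s t y))
      (Measure.infinitePi fun y => expMeasure (α / boundaryFactor s t y)) := by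
    intro k m
    refine measurePreserving_update₃ _ (by simp) (by simp) (by simp) ?_
    have h := measurePreserving_burkeMap (div_pos hα hs) (div_pos hα ht)
    have h1 : α / s + α / t = α := by
      rw [div_eq_mul_one_div α s, div_eq_mul_one_div α t, ← mul_add, hst, mul_one]
    rw [h1] at h
    simpa [boundaryFactor] using h
  have hrow : ∀ k m, MeasurePreserving (rowSweep m k)
      (Measure.infinitePi fun y => expMeasure (α / boundaryFactor s t y))
      (Measure.infinitePi fun y => expMeasure (α / boundaryFactor s t y)) := by
    intro k m
    induction k with
    | zero => exact MeasurePreserving.id _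
    | succ k ih => exact (hstep k m).comp ih
  induction m with
  | zero => exact MeasurePreserving.id _
  | succ m ih => exact (hrow n m).comp ih

theorem scaledPassage_eq_add (s t : ℝ) (z : ℕ × ℕ → ℝ) (n m : ℕ) :
    scaledPassage s t z n m = t * colSum z m + rowSum (sweep n m (scaleBoundary s t z)) n := by
  rw [scaledPassage, gridPassage_eq_sum_sweep]
  simp [colSum, Finset.mul_sum]

/-- Burke's property: in the stationary model the increments along a row have the law of the
increments along the axis. -/
theorem map_rowSum_sweep {α s t : ℝ} (hα : 0 < α) (hs : 0 < s) (ht : 0 < t)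
    (hst : 1 / s + 1 / t = 1) (n m : ℕ) :
    (expField α).map (fun z => rowSum (sweep n m (scaleBoundary s t z)) n) =
      (expField α).map (fun z => s * rowSum z n) := by
  have h := measurePreserving_sweep hα hs ht hst n m
  have hm := measurable_rowSum n
  have hmb := measurable_scaleBoundary s t
  have h1 : ((expField α).map (scaleBoundary s t)).map (fun w => rowSum (sweep n m w) n) =
      ((expField α).map (scaleBoundary s t)).map (fun w => rowSum w n) := by
    conv_rhs => rw [← h.map_eq, Measure.map_map hm h.measurable]
    rfl
  have hms : Measurable fun w => rowSum (sweep n m w) n := hm.comp h.measurable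
  rw [Measure.map_map hms hmb, Measure.map_map hm hmb] at h1
  refine h1.trans ?_
  congr 1
  ext z
  simp [rowSum, Finset.mul_sum]

/-! ### Exponential concentration -/

/-- The probabilities of the events `E N` decay exponentially in `N`. -/
def ExpRare {Ω : Type*} [MeasurableSpace Ω] (μ : Measure Ω) (E : ℕ → Set Ω) : Prop :=
  ∃ c : ℝ, 0 < c ∧ ∀ᶠ N : ℕ in atTop, μ.real (E N) ≤ Real.exp (-c * N)

/-- `Y N / N` converges to `ℓ` in probability, exponentially fast. -/
def ConcentratesAt {Ω : Type*} [MeasurableSpace Ω] (μ : Measure Ω) (Y : ℕ → Ω → ℝ) (ℓ : ℝ) :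
    Prop :=
  ∀ ε : ℝ, 0 < ε → ExpRare μ fun N => {ω | ε < |Y N ω / N - ℓ|}

section Rare

variable {Ω : Type*} [MeasurableSpace Ω] {μ : Measure Ω}

theorem ExpRare.of_le_const_mul {E : ℕ → Set Ω} {C c : ℝ} (hc : 0 < c)
    (h : ∀ᶠ N : ℕ in atTop, μ.real (E N) ≤ C * Real.exp (-c * N)) : ExpRare μ E := by
  refine ⟨c / 2, by positivity, ?_⟩
  have hlim : Tendsto (fun N : ℕ => Real.exp (c / 2 * N)) atTop atTop :=
    Real.tendsto_exp_atTop.comp (tendsto_natCast_atTop_atTop.const_mul_atTop (by positivity))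
  filter_upwards [h, hlim.eventually_ge_atTop C] with N h1 h2
  calc μ.real (E N) ≤ C * Real.exp (-c * N) := h1
    _ ≤ Real.exp (c / 2 * N) * Real.exp (-c * N) := by gcongr
    _ = Real.exp (-(c / 2) * N) := by rw [← Real.exp_add]; congr 1; ring

theorem concentratesAt_of_tendsto {y : ℕ → ℝ} {a : ℝ}
    (h : Tendsto (fun N => y N / N) atTop (𝓝 a)) : ConcentratesAt μ (fun N _ => y N) a := by
  intro ε hε
  refine ⟨1, one_pos, ?_⟩
  filter_upwards [Metric.tendsto_nhds.1 h ε hε] with N hN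
  rw [Real.dist_eq] at hN
  simp [hN.not_gt, Real.exp_nonneg]

theorem ConcentratesAt.congr_law {Y Z : ℕ → Ω → ℝ} {a : ℝ} (hY : ConcentratesAt μ Y a)
    (hYm : ∀ N, Measurable (Y N)) (hZm : ∀ N, Measurable (Z N))
    (h : ∀ N, μ.map (Z N) = μ.map (Y N)) : ConcentratesAt μ Z a := by
  intro ε hε
  obtain ⟨c, hc, hE⟩ := hY ε hε
  refine ⟨c, hc, hE.mono fun N hN => ?_⟩
  have hs : MeasurableSet {x : ℝ | ε < |x / N - a|} :=
    measurableSet_lt measurable_const (by fun_prop)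
  have h1 := map_measureReal_apply (μ := μ) (hYm N) hs
  have h2 := map_measureReal_apply (μ := μ) (hZm N) hs
  rw [h N, h1] at h2
  exact h2.symm.trans_le hN

theorem ExpRare.union {E F : ℕ → Set Ω} (hE : ExpRare μ E) (hF : ExpRare μ F) :
    ExpRare μ fun N => E N ∪ F N := by
  obtain ⟨c, hc, hE⟩ := hE
  obtain ⟨d, hd, hF⟩ := hF
  refine ExpRare.of_le_const_mul (C := 2) (lt_min hc hd) ?_
  filter_upwards [hE, hF] with N h1 h2
  have h3 : Real.exp (-c * N) ≤ Real.exp (-(min c d) * N) := by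
    gcongr; exact min_le_left _ _
  have h4 : Real.exp (-d * N) ≤ Real.exp (-(min c d) * N) := by
    gcongr; exact min_le_right _ _
  linarith [measureReal_union_le (μ := μ) (E N) (F N)]

variable [IsFiniteMeasure μ]

theorem ExpRare.mono_ae {E F : ℕ → Set Ω} (hF : ExpRare μ F) (h : ∀ᶠ N in atTop, E N ≤ᵐ[μ] F N) :
    ExpRare μ E := by
  obtain ⟨c, hc, hF⟩ := hF
  refine ⟨c, hc, ?_⟩
  filter_upwards [hF, h] with N h1 h2
  exact (ENNReal.toReal_mono (measure_ne_top _ _) (measure_mono_ae h2)).trans h1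

theorem ExpRare.mono {E F : ℕ → Set Ω} (hF : ExpRare μ F) (h : ∀ᶠ N in atTop, E N ⊆ F N) :
    ExpRare μ E :=
  hF.mono_ae (h.mono fun _ hN => hN.eventuallyLE)

theorem ConcentratesAt.add {Y Z : ℕ → Ω → ℝ} {a b : ℝ} (hY : ConcentratesAt μ Y a)
    (hZ : ConcentratesAt μ Z b) : ConcentratesAt μ (fun N ω => Y N ω + Z N ω) (a + b) := by
  intro ε hε
  refine ((hY (ε / 2) (by positivity)).union (hZ (ε / 2) (by positivity))).mono
    (Eventually.of_forall fun N ω hω => ?_)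
  by_contra hcon
  simp only [Set.mem_union, Set.mem_ofPred_eq, not_or, not_lt] at hcon hω
  have : (Y N ω + Z N ω) / N - (a + b) = (Y N ω / N - a) + (Z N ω / N - b) := by ring
  rw [this] at hω
  linarith [abs_add_le (Y N ω / N - a) (Z N ω / N - b), hcon.1, hcon.2]

theorem ConcentratesAt.const_mul {Y : ℕ → Ω → ℝ} {a : ℝ} (hY : ConcentratesAt μ Y a) (k : ℝ) :
    ConcentratesAt μ (fun N ω => k * Y N ω) (k * a) := by
  intro ε hε
  refine (hY (ε / (|k| + 1)) (by positivity)).mono (Eventually.of_forall fun N ω hω => ?_)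
  simp only [Set.mem_ofPred_eq] at hω ⊢
  have : k * Y N ω / N - k * a = k * (Y N ω / N - a) := by ring
  rw [this, abs_mul] at hω
  rw [div_lt_iff₀ (by positivity)]
  nlinarith [abs_nonneg (Y N ω / N - a)]

theorem ConcentratesAt.sub {Y Z : ℕ → Ω → ℝ} {a b : ℝ} (hY : ConcentratesAt μ Y a)
    (hZ : ConcentratesAt μ Z b) : ConcentratesAt μ (fun N ω => Y N ω - Z N ω) (a - b) := by
  simpa [sub_eq_add_neg] using hY.add (hZ.const_mul (-1))

theorem ConcentratesAt.expRare_le {Y : ℕ → Ω → ℝ} {a b : ℝ} (hY : ConcentratesAt μ Y a)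
    (hab : b < a) : ExpRare μ fun N => {ω | Y N ω ≤ b * N} := by
  refine (hY ((a - b) / 2) (by linarith)).mono ?_
  filter_upwards [eventually_gt_atTop 0] with N hN ω hω
  have hN' : (0 : ℝ) < N := by exact_mod_cast hN
  have h1 : Y N ω / N ≤ b := (div_le_iff₀ hN').2 hω
  have := neg_abs_le (Y N ω / N - a)
  simp only [Set.mem_ofPred_eq]
  linarith

end Rare

/-! ### Sums of exponential variables -/

theorem lintegral_exp_mul_expMeasure {r s : ℝ} (hr : 0 < r) (hs : s < r) :
    ∫⁻ x, ENNReal.ofReal (Real.exp (s * x)) ∂expMeasure r = ENNReal.ofReal (r / (r - s)) := by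
  have hrs : 0 < r - s := sub_pos.2 hs
  rw [expMeasure_eq_withDensity, lintegral_withDensity_eq_lintegral_mul _
    (measurable_exponentialPDF r) (by fun_prop)]
  have h : ∀ x, (exponentialPDF r * fun x => ENNReal.ofReal (Real.exp (s * x))) x =
      ENNReal.ofReal (r / (r - s)) * exponentialPDF (r - s) x := by
    intro x
    rw [Pi.mul_apply]
    rcases lt_or_ge x 0 with hx | hx
    · simp [exponentialPDF_of_neg hx]
    · rw [exponentialPDF_of_nonneg hx, exponentialPDF_of_nonneg hx,
        ← ENNReal.ofReal_mul (by positivity), ← ENNReal.ofReal_mul (by positivity), mul_assoc,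
        ← Real.exp_add]
      congr 1
      rw [← mul_assoc, div_mul_cancel₀ _ hrs.ne']
      congr 2
      ring
  rw [lintegral_congr h, lintegral_const_mul _ (measurable_exponentialPDF _),
    lintegral_exponentialPDF_eq_one hrs, mul_one]

theorem integrable_exp_mul_expMeasure {r s : ℝ} (hr : 0 < r) (hs : s < r) :
    Integrable (fun x => Real.exp (s * x)) (expMeasure r) := by
  refine ⟨by fun_prop, ?_⟩
  rw [hasFiniteIntegral_iff_ofReal (ae_of_all _ fun x => Real.exp_nonneg _),
    lintegral_exp_mul_expMeasure hr hs]
  exact ENNReal.ofReal_lt_top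

theorem mgf_id_expMeasure {r s : ℝ} (hr : 0 < r) (hs : s < r) :
    mgf id (expMeasure r) s = r / (r - s) := by
  have hrs : 0 < r - s := sub_pos.2 hs
  simp only [mgf, id]
  rw [integral_eq_lintegral_of_nonneg_ae (ae_of_all _ fun x => Real.exp_nonneg _) (by fun_prop),
    lintegral_exp_mul_expMeasure hr hs, ENNReal.toReal_ofReal (by positivity)]

/-- Bounds the moment generating function of an exponential variable: the linear term `u` is the
mean, and only a quadratic term remains after centering. -/
theorem inv_one_sub_le_exp {u : ℝ} (hu : u ≤ 1 / 2) :
    1 / (1 - u) ≤ Real.exp (u + 2 * u ^ 2) := by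
  rw [div_le_iff₀ (by linarith)]
  have h := Real.add_one_le_exp (u + 2 * u ^ 2)
  nlinarith [mul_le_mul_of_nonneg_right h (by linarith : 0 ≤ 1 - u),
    mul_nonneg (sq_nonneg u) (by linarith : 0 ≤ 1 - 2 * u)]

section ExpField

variable {α : ℝ}

theorem isProbabilityMeasure_expField (hα : 0 < α) : IsProbabilityMeasure (expField α) := by
  have := isProbabilityMeasure_expMeasure hα
  unfold expField
  infer_instance

theorem map_eval_expField (hα : 0 < α) (y : ℕ × ℕ) :
    (expField α).map (fun z => z y) = expMeasure α := by
  have := isProbabilityMeasure_expMeasure hα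
  exact Measure.infinitePi_map_eval (fun _ : ℕ × ℕ => expMeasure α) y

/-- The exponent is `α * u` so that the moment generating function of a summand is `1 / (1 - u)`. -/
theorem expField_chernoff (hα : 0 < α) {f : ℕ → ℕ × ℕ} (hf : f.Injective) {u : ℝ}
    (hu : u ≤ 1 / 2) (n : ℕ) :
    Integrable (fun z => Real.exp ((α * u) * ∑ i ∈ Finset.range n, z (f i))) (expField α) ∧
    mgf (fun z => ∑ i ∈ Finset.range n, z (f i)) (expField α) (α * u) ≤
      Real.exp (n * (u + 2 * u ^ 2)) := by
  have := isProbabilityMeasure_expMeasure hα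
  have := isProbabilityMeasure_expField hα
  have hind : iIndepFun (fun (i : ℕ) (z : ℕ × ℕ → ℝ) => z (f i)) (expField α) :=
    (iIndepFun_infinitePi (P := fun _ : ℕ × ℕ => expMeasure α) (X := fun _ x => x)
      (fun _ => measurable_id)).precomp hf
  have hm : ∀ i, Measurable fun z : ℕ × ℕ → ℝ => z (f i) := fun i => measurable_pi_apply _
  have hlt : α * u < α := by nlinarith
  have hint : ∀ i, Integrable (fun z : ℕ × ℕ → ℝ => Real.exp ((α * u) * z (f i)))
      (expField α) := by
    intro i
    have h := integrable_exp_mul_expMeasure hα hlt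
    rw [← map_eval_expField hα (f i)] at h
    exact h.comp_measurable (hm i)
  have hmgf : ∀ i, mgf (fun z : ℕ × ℕ → ℝ => z (f i)) (expField α) (α * u) = 1 / (1 - u) := by
    intro i
    have h := mgf_id_expMeasure hα hlt
    rw [← map_eval_expField hα (f i), mgf_id_map (hm i).aemeasurable] at h
    rw [h]
    have : 1 - u ≠ 0 := by linarith
    field_simp
  have hfun : (fun z : ℕ × ℕ → ℝ => ∑ i ∈ Finset.range n, z (f i)) =
      ∑ i ∈ Finset.range n, fun z : ℕ × ℕ → ℝ => z (f i) := by ext z; simp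
  constructor
  · have := hind.integrable_exp_mul_sum hm (s := Finset.range n) (fun i _ => hint i)
    simpa using this
  · rw [hfun, hind.mgf_sum hm]
    simp only [hmgf, Finset.prod_const, Finset.card_range]
    rw [Real.exp_nat_mul]
    exact pow_le_pow_left₀ (div_nonneg zero_le_one (by linarith)) (inv_one_sub_le_exp hu) n

/-- The law of large numbers with exponential rate for sums of distinct coordinates. -/
theorem concentratesAt_sum (hα : 0 < α) {f : ℕ → ℕ × ℕ} (hf : f.Injective) {n : ℕ → ℕ} {t : ℝ}
    (hn : Tendsto (fun N => (n N : ℝ) / N) atTop (𝓝 t)) :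
    ConcentratesAt (expField α) (fun N z => ∑ i ∈ Finset.range (n N), z (f i)) (t / α) := by
  have := isProbabilityMeasure_expField hα
  have hcenter : ConcentratesAt (expField α)
      (fun N z => ∑ i ∈ Finset.range (n N), z (f i) - n N / α) 0 := by
    intro ε hε
    set C : ℝ := |t| + 1 with hC
    have hCpos : 0 < C := by positivity
    set u : ℝ := min (1 / 2) (α * ε / (4 * C)) with hu
    have hu0 : 0 < u := lt_min (by norm_num) (by positivity)
    have hu1 : u ≤ 1 / 2 := min_le_left _ _
    have hu2 : u * (4 * C) ≤ α * ε := (le_div_iff₀ (by positivity)).1 (min_le_right _ _)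
    refine ExpRare.of_le_const_mul (C := 2) (c := u * (α * ε / 2)) (by positivity) ?_
    have hle : ∀ᶠ N in atTop, (n N : ℝ) / N < C :=
      hn.eventually_lt_const ((le_abs_self t).trans_lt (lt_add_one _))
    filter_upwards [hle, eventually_gt_atTop 0] with N hN hN0
    have hN' : (0 : ℝ) < N := by exact_mod_cast hN0
    rw [div_lt_iff₀ hN'] at hN
    -- The choice of `u` makes the quadratic term at most half of the linear one.
    have hexp : -(α * u * ε * N) + n N * (2 * u ^ 2) ≤ -(u * (α * ε / 2)) * N := by
      have h1 : (n N : ℝ) * (2 * u ^ 2) ≤ C * N * (2 * u ^ 2) := by gcongr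
      have h2 : u * (4 * C) * (u * N / 2) ≤ α * ε * (u * N / 2) := by gcongr
      nlinarith
    obtain ⟨hi₁, hm₁⟩ := expField_chernoff hα hf hu1 (n N)
    obtain ⟨hi₂, hm₂⟩ := expField_chernoff hα hf (u := -u) (by linarith) (n N)
    have hup := measure_ge_le_exp_mul_mgf (n N / α + ε * N) (by positivity) hi₁
    have hlow := measure_le_le_exp_mul_mgf (n N / α - ε * N) (by nlinarith) hi₂
    have hup' : Real.exp (-(α * u) * (n N / α + ε * N)) *
        mgf (fun z => ∑ i ∈ Finset.range (n N), z (f i)) (expField α) (α * u) ≤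
        Real.exp (-(u * (α * ε / 2)) * N) := by
      refine (mul_le_mul_of_nonneg_left hm₁ (Real.exp_nonneg _)).trans ?_
      rw [← Real.exp_add, Real.exp_le_exp]
      refine le_of_eq_of_le ?_ hexp
      field_simp
      ring
    have hlow' : Real.exp (-(α * -u) * (n N / α - ε * N)) *
        mgf (fun z => ∑ i ∈ Finset.range (n N), z (f i)) (expField α) (α * -u) ≤
        Real.exp (-(u * (α * ε / 2)) * N) := by
      refine (mul_le_mul_of_nonneg_left hm₂ (Real.exp_nonneg _)).trans ?_
      rw [← Real.exp_add, Real.exp_le_exp]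
      refine le_of_eq_of_le ?_ hexp
      field_simp
      ring
    have hsub : {z : ℕ × ℕ → ℝ |
        ε < |(∑ i ∈ Finset.range (n N), z (f i) - n N / α) / N - 0|} ⊆
        {z | n N / α + ε * N ≤ ∑ i ∈ Finset.range (n N), z (f i)} ∪
        {z | ∑ i ∈ Finset.range (n N), z (f i) ≤ n N / α - ε * N} := by
      intro z hz
      simp only [Set.mem_ofPred_eq, sub_zero, lt_abs, ← neg_div, lt_div_iff₀ hN'] at hz
      rcases hz with hz | hz
      · exact Or.inl (by rw [Set.mem_ofPred_eq]; linarith)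
      · exact Or.inr (by rw [Set.mem_ofPred_eq]; linarith)
    have := measureReal_mono (μ := expField α) hsub
    linarith [measureReal_union_le (μ := expField α)
      {z | n N / α + ε * N ≤ ∑ i ∈ Finset.range (n N), z (f i)}
      {z | ∑ i ∈ Finset.range (n N), z (f i) ≤ n N / α - ε * N}]
  have hmean : ConcentratesAt (expField α) (fun N _ => (n N : ℝ) / α) (t / α) := by
    refine concentratesAt_of_tendsto ((hn.div_const α).congr fun N => ?_)
    ring
  simpa using hcenter.add hmean

theorem concentratesAt_rowSum (hα : 0 < α) {n : ℕ → ℕ} {t : ℝ}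
    (hn : Tendsto (fun N => (n N : ℝ) / N) atTop (𝓝 t)) :
    ConcentratesAt (expField α) (fun N z => rowSum z (n N)) (t / α) :=
  concentratesAt_sum hα (f := fun i => (i + 1, 0)) (fun i j h => by simpa using h) hn

theorem concentratesAt_colSum (hα : 0 < α) {n : ℕ → ℕ} {t : ℝ}
    (hn : Tendsto (fun N => (n N : ℝ) / N) atTop (𝓝 t)) :
    ConcentratesAt (expField α) (fun N z => colSum z (n N)) (t / α) :=
  concentratesAt_sum hα (f := fun i => (0, i + 1)) (fun i j h => by simpa using h) hn

theorem ae_nonneg_expMeasure (r : ℝ) : ∀ᵐ x ∂expMeasure r, 0 ≤ x := by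
  have := lintegral_exponentialPDF_of_nonpos (r := r) le_rfl
  rw [← withDensity_apply _ measurableSet_Iio, ← expMeasure_eq_withDensity] at this
  simpa [ae_iff, Set.Iio_def] using this

theorem ae_nonneg_expField (hα : 0 < α) : ∀ᵐ z ∂expField α, ∀ y, 0 ≤ z y := by
  rw [ae_all_iff]
  intro y
  have h := ae_nonneg_expMeasure α
  rw [← map_eval_expField hα y] at h
  exact ae_of_ae_map (measurable_pi_apply y).aemeasurable h

/-- The stationary passage value is the sum of two sums of independent exponential variables, each
of which concentrates. The two need not be independent of each other. -/
theorem concentratesAt_scaledPassage (hα : 0 < α) {s t : ℝ} (hs : 0 < s) (ht : 0 < t)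
    (hst : 1 / s + 1 / t = 1) {m : ℕ → ℕ} {β : ℝ}
    (hm : Tendsto (fun N => (m N : ℝ) / N) atTop (𝓝 β)) :
    ConcentratesAt (expField α) (fun N z => scaledPassage s t z N (m N)) ((s + t * β) / α) := by
  have := isProbabilityMeasure_expField hα
  have hid : Tendsto (fun N : ℕ => ((id N : ℕ) : ℝ) / N) atTop (𝓝 1) := by
    refine tendsto_const_nhds.congr' ?_
    filter_upwards [eventually_gt_atTop 0] with N hN
    have hN' : (0 : ℝ) < N := by exact_mod_cast hN
    simp [hN'.ne']
  have hsweep : ConcentratesAt (expField α)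
      (fun N z => rowSum (sweep N (m N) (scaleBoundary s t z)) N) (s * (1 / α)) :=
    ((concentratesAt_rowSum hα hid).const_mul s).congr_law
      (fun N => (measurable_rowSum N).const_mul s)
      (fun N => by
        have h := (measurable_scaledPassage s t N (m N)).sub ((measurable_colSum (m N)).const_mul t)
        simpa only [scaledPassage_eq_add, Pi.sub_def, add_sub_cancel_left] using h)
      fun N => map_rowSum_sweep hα hs ht hst N (m N)
  have := ((concentratesAt_colSum hα hm).const_mul t).add hsweep
  simp only [← scaledPassage_eq_add] at this
  convert this using 1
  ring

end ExpField

/-! ### The bulk passage value -/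

/-- The law of large numbers, with exponential rate, for the bulk passage value. The parameter `b` is
the square root of the aspect ratio; the stationary models are parametrized by `d > 0` through the
factors `1 + d` and `1 + 1 / d`. -/
theorem concentratesAt_scaledPassage_zero {α b : ℝ} (hα : 0 < α) (hb : 0 < b) {m : ℕ → ℕ}
    (hm : Tendsto (fun N => (m N : ℝ) / N) atTop (𝓝 (b ^ 2))) :
    ConcentratesAt (expField α) (fun N z => scaledPassage 0 0 z N (m N)) ((1 + b) ^ 2 / α) := by
  have := isProbabilityMeasure_expField hα
  have hstat : ∀ d : ℝ, 0 < d → ConcentratesAt (expField α)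
      (fun N z => scaledPassage (1 + d) (1 + 1 / d) z N (m N))
      ((1 + d + (1 + 1 / d) * b ^ 2) / α) := fun d hd =>
    concentratesAt_scaledPassage hα (by positivity) (by positivity) (by field_simp; ring) hm
  have hL : (1 + b + (1 + 1 / b) * b ^ 2) / α = (1 + b) ^ 2 / α := by
    congr 1; field_simp; ring
  have h0 := hstat b hb
  rw [hL] at h0
  intro δ hδ
  -- `η N` is the length of the part of an axis whose weight is negligible against `δ N`.
  obtain ⟨η, hη, hηs, hηt⟩ : ∃ η : ℝ, 0 < η ∧ (1 + b) * (η / α) < δ ∧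
      (1 + 1 / b) * (η / α) < δ := by
    have hpos : 0 < (1 + b) + (1 + 1 / b) := by positivity
    refine ⟨δ * α / (2 * ((1 + b) + (1 + 1 / b))), by positivity, ?_, ?_⟩
    · rw [show (1 + b) * (δ * α / (2 * ((1 + b) + (1 + 1 / b))) / α) =
        δ * ((1 + b) / (2 * ((1 + b) + (1 + 1 / b)))) by field_simp]
      refine mul_lt_of_lt_one_right hδ ((div_lt_one (by positivity)).2 ?_)
      have : 0 < 1 / b := by positivity
      linarith
    · rw [show (1 + 1 / b) * (δ * α / (2 * ((1 + b) + (1 + 1 / b))) / α) =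
        δ * ((1 + 1 / b) / (2 * ((1 + b) + (1 + 1 / b)))) by field_simp]
      refine mul_lt_of_lt_one_right hδ ((div_lt_one (by positivity)).2 ?_)
      have : 0 < 1 / b := by positivity
      linarith
  have hk : Tendsto (fun N : ℕ => ((⌊η * N⌋₊ : ℕ) : ℝ) / N) atTop (𝓝 η) :=
    (tendsto_nat_floor_mul_div_atTop hη.le).comp tendsto_natCast_atTop_atTop
  have hrow := concentratesAt_rowSum hα hk
  have hcol := concentratesAt_colSum hα hk
  have h1 := (h0.sub (hrow.const_mul (1 + b))).expRare_le
    (b := (1 + b) ^ 2 / α - δ) (by linarith)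
  have h3 := (h0.sub (hcol.const_mul (1 + 1 / b))).expRare_le
    (b := (1 + b) ^ 2 / α - δ) (by linarith)
  -- The mean of the stationary passage value is minimal at `d = b`, so changing `d` raises it only to
  -- second order, while the paths that stay on an axis for `η N` steps gain to first order.
  set b₁ : ℝ := b * (1 + η / 2) with hb₁
  have hb₁pos : 0 < b₁ := by positivity
  have hb₁le : b ≤ b₁ := by nlinarith
  have h2 := (h0.sub ((hstat b₁ hb₁pos).sub (hrow.const_mul (b₁ - b)))).expRare_le (b := 0) (by
    have : (1 + b) ^ 2 / α - ((1 + b₁ + (1 + 1 / b₁) * b ^ 2) / α - (b₁ - b) * (η / α)) =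
        b * η ^ 2 * (1 + η) / (4 * (1 + η / 2)) / α := by
      rw [hb₁]; field_simp; ring
    rw [this]
    positivity)
  set b₂ : ℝ := b / (1 + η / (2 * b ^ 2)) with hb₂
  have hb₂pos : 0 < b₂ := by positivity
  have hb₂inv : 1 / b₂ = 1 / b + η / (2 * b ^ 3) := by
    rw [hb₂]; field_simp
  have hb₂le : 1 / b ≤ 1 / b₂ := by
    rw [hb₂inv]; linarith [show 0 < η / (2 * b ^ 3) by positivity]
  have h4 := (h0.sub ((hstat b₂ hb₂pos).sub (hcol.const_mul (1 / b₂ - 1 / b)))).expRare_le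
    (b := 0) (by
    have : (1 + b) ^ 2 / α -
        ((1 + b₂ + (1 + 1 / b₂) * b ^ 2) / α - (1 / b₂ - 1 / b) * (η / α)) =
        η ^ 2 * (1 / b ^ 3) * (b ^ 2 + η) / (4 * (b ^ 2 + η / 2)) / α := by
      rw [hb₂inv, hb₂]; field_simp; ring
    rw [this]
    positivity)
  refine ((h0 δ hδ).union ((h1.union h2).union (h3.union h4))).mono_ae ?_
  filter_upwards [eventually_gt_atTop 0] with N hN
  have hN' : (0 : ℝ) < N := by exact_mod_cast hN
  filter_upwards [ae_nonneg_expField hα] with z hz hzδ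
  change z ∈ (_ : Set (ℕ × ℕ → ℝ))
  replace hzδ : δ < |scaledPassage 0 0 z N (m N) / N - (1 + b) ^ 2 / α| := hzδ
  rcases lt_abs.1 hzδ with h | h
  · refine Or.inl ?_
    rw [Set.mem_ofPred_eq, lt_abs]
    have hle : scaledPassage 0 0 z N (m N) ≤ scaledPassage (1 + b) (1 + 1 / b) z N (m N) :=
      scaledPassage_mono (by positivity) (by positivity) hz _ _
    have := div_le_div_of_nonneg_right hle hN'.le
    exact Or.inl (by linarith)
  · refine Or.inr ?_
    have hG : scaledPassage 0 0 z N (m N) < ((1 + b) ^ 2 / α - δ) * N := by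
      rw [← div_lt_iff₀ hN']; linarith
    have hexit := scaledPassage_le_exit (s := 1 + b) (t := 1 + 1 / b) (s₁ := 1 + b₁)
      (t₁ := 1 + 1 / b₁) (s₂ := 1 + b₂) (t₂ := 1 + 1 / b₂) (by positivity) (by positivity)
      (by linarith) (by linarith) hz ⌊η * N⌋₊ N (m N)
    rcases le_max_iff.1 hexit with hexit | hexit
    · refine Or.inl ?_
      rcases le_max_iff.1 hexit with hexit | hexit
      · exact Or.inl (by rw [Set.mem_ofPred_eq]; linarith)
      · exact Or.inr (by rw [Set.mem_ofPred_eq]; linarith)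
    · refine Or.inr ?_
      rcases le_max_iff.1 hexit with hexit | hexit
      · exact Or.inl (by rw [Set.mem_ofPred_eq]; linarith)
      · exact Or.inr (by rw [Set.mem_ofPred_eq]; linarith)

/-! ### Deviations at finite size -/

theorem expMeasure_Ioc_pos {r a b : ℝ} (hr : 0 < r) (ha : 0 ≤ a) (hab : a < b) :
    0 < expMeasure r (Set.Ioc a b) := by
  have := isProbabilityMeasure_expMeasure hr
  rw [← measure_cdf (expMeasure r), StieltjesFunction.measure_Ioc, cdf_expMeasure_eq hr,
    cdf_expMeasure_eq hr, if_pos ha, if_pos (ha.trans hab.le), ENNReal.ofReal_pos, sub_pos]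
  gcongr

theorem corner_le_scaledPassage {z : ℕ × ℕ → ℝ} (hz : ∀ y, 0 ≤ z y) (i j : ℕ) :
    z (1, 1) ≤ scaledPassage 0 0 z (i + 1) (j + 1) := by
  induction i with
  | zero =>
    induction j with
    | zero => simp [scaledPassage_succ_succ, scaledPassage_col, scaledPassage_row]
    | succ j ihj => linarith [scaledPassage_step_down 0 0 z 0 (j + 1), hz (0 + 1, j + 1 + 1)]
  | succ i ihi => linarith [scaledPassage_step_left 0 0 z (i + 1) j, hz (i + 1 + 1, j + 1)]

theorem scaledPassage_le_corner_add {z : ℕ × ℕ → ℝ} {N M : ℕ} {ε : ℝ} (hε : 0 ≤ ε)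
    (h11 : 0 ≤ z (1, 1))
    (h : ∀ i < N, ∀ j < M, (i, j) ≠ (0, 0) → z (i + 1, j + 1) ≤ ε) {n m : ℕ} (hn : n ≤ N)
    (hm : m ≤ M) : scaledPassage 0 0 z n m ≤ z (1, 1) + (n + m) * ε := by
  induction n generalizing m with
  | zero => rw [scaledPassage_col]; nlinarith [mul_nonneg (Nat.cast_nonneg (α := ℝ) m) hε]
  | succ n ihn =>
    induction m with
    | zero =>
      rw [scaledPassage_row]; nlinarith [mul_nonneg (Nat.cast_nonneg (α := ℝ) (n + 1)) hε]
    | succ m ihm =>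
      rw [scaledPassage_succ_succ]
      by_cases h0 : (n, m) = (0, 0)
      · obtain ⟨rfl, rfl⟩ := Prod.mk.inj h0
        simp [scaledPassage_col, scaledPassage_row]
        linarith
      · have hz := h n (by omega) m (by omega) h0
        have h1 := ihn (by omega) hm
        have h2 := ihm (by omega)
        have h3 : max (scaledPassage 0 0 z n (m + 1)) (scaledPassage 0 0 z (n + 1) m) ≤
            z (1, 1) + (n + m + 1) * ε := by
          push_cast at h1 h2
          exact max_le (by linarith) (by linarith)
        push_cast
        linarith

/-- No deviation event is certain: with positive probability the weight at `(1, 1)` is close to `N * L`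
and all others are small. -/
theorem expField_deviation_lt_one {α L δ : ℝ} (hα : 0 < α) (hL : 0 < L) (hδ : 0 < δ) {N M : ℕ}
    (hN : 1 ≤ N) (hM : 1 ≤ M) :
    (expField α).real {z | δ < |scaledPassage 0 0 z N M / N - L|} < 1 := by
  have := isProbabilityMeasure_expMeasure hα
  have := isProbabilityMeasure_expField hα
  have hN' : (0 : ℝ) < N := by exact_mod_cast hN
  set ε : ℝ := N * δ / (N + M) with hε
  have hεpos : 0 < ε := by positivity
  set t : ℕ × ℕ → Set ℝ := fun y =>
    if y = (1, 1) then Set.Ioc (max 0 (N * (L - δ))) (N * L) else Set.Ioc 0 ε with ht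
  set F : Finset (ℕ × ℕ) := Finset.Icc 1 N ×ˢ Finset.Icc 1 M
  have hbox : 0 < expField α ((F : Set (ℕ × ℕ)).pi t) := by
    rw [expField, Measure.infinitePi_pi]
    · refine pos_iff_ne_zero.2 (Finset.prod_ne_zero_iff.2 fun y _ => pos_iff_ne_zero.1 ?_)
      simp only [ht]
      split_ifs
      · exact expMeasure_Ioc_pos hα (le_max_left _ _)
          (max_lt (by positivity) (by nlinarith))
      · exact expMeasure_Ioc_pos hα le_rfl hεpos
    · intro y _
      simp only [ht]
      split_ifs <;> exact measurableSet_Ioc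
  have hmeas : MeasurableSet {z : ℕ × ℕ → ℝ | δ < |scaledPassage 0 0 z N M / N - L|} := by
    have := measurable_scaledPassage 0 0 N M
    exact measurableSet_lt measurable_const (by fun_prop)
  have hsub : (F : Set (ℕ × ℕ)).pi t ≤ᵐ[expField α]
      {z : ℕ × ℕ → ℝ | δ < |scaledPassage 0 0 z N M / N - L|}ᶜ := by
    filter_upwards [ae_nonneg_expField hα] with z hz hzt
    change z ∈ {z : ℕ × ℕ → ℝ | δ < |scaledPassage 0 0 z N M / N - L|}ᶜ
    replace hzt : z ∈ (F : Set (ℕ × ℕ)).pi t := hzt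
    have h11 : z (1, 1) ∈ t (1, 1) := hzt (1, 1) (by simp [F, hN, hM])
    simp only [ht, if_true] at h11
    have hsmall : ∀ i < N, ∀ j < M, (i, j) ≠ (0, 0) → z (i + 1, j + 1) ≤ ε := by
      intro i hi j hj hij
      have h := hzt (i + 1, j + 1) (by simp [F]; omega)
      have hne : ((i + 1, j + 1) : ℕ × ℕ) ≠ (1, 1) := by simpa using hij
      simp only [ht, if_neg hne] at h
      exact h.2
    have hup := scaledPassage_le_corner_add hεpos.le (hz _) hsmall le_rfl le_rfl
    have hlow : z (1, 1) ≤ scaledPassage 0 0 z N M := by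
      obtain ⟨i, rfl⟩ := Nat.exists_eq_add_of_le' hN
      obtain ⟨j, rfl⟩ := Nat.exists_eq_add_of_le' hM
      exact corner_le_scaledPassage hz i j
    have hNM : ((N : ℝ) + M) * ε = N * δ := by
      rw [hε]; field_simp
    have hlow' := (le_max_right _ _).trans_lt h11.1
    simp only [Set.mem_compl_iff, Set.mem_ofPred_eq, not_lt, abs_le]
    constructor
    · have : L - δ ≤ scaledPassage 0 0 z N M / N := by
        rw [le_div_iff₀ hN']; linarith
      linarith
    · have : scaledPassage 0 0 z N M / N ≤ L + δ := by
        rw [div_le_iff₀ hN']; linarith [h11.2]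
      linarith
  have hpos : 0 < (expField α).real
      {z : ℕ × ℕ → ℝ | δ < |scaledPassage 0 0 z N M / N - L|}ᶜ :=
    ENNReal.toReal_pos (hbox.trans_le (measure_mono_ae hsub)).ne' (measure_ne_top _ _)
  rw [probReal_compl_eq_one_sub hmeas] at hpos
  linarith

/-- An eventual exponential bound extends to all `N` by lowering the rate, if the finitely many
remaining values are less than `1`. -/
theorem exists_exp_bound_of_eventually {f : ℕ → ℝ} {A : ℕ → Prop} {c : ℝ} (hc : 0 < c)
    (h : ∀ᶠ N : ℕ in atTop, f N ≤ Real.exp (-c * N)) (hA : ∀ N, A N → 0 < N)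
    (hf : ∀ N, A N → f N < 1) :
    ∃ c : ℝ, 0 < c ∧ ∀ N : ℕ, A N → f N ≤ Real.exp (-c * N) := by
  have hmono : ∀ {c d : ℝ} {N : ℕ}, c ≤ d → Real.exp (-d * N) ≤ Real.exp (-c * N) := by
    intro c d N hcd
    gcongr
  have hfin : ∀ K : ℕ, ∃ d : ℝ, 0 < d ∧ ∀ N < K, A N → f N ≤ Real.exp (-d * N) := by
    intro K
    induction K with
    | zero => exact ⟨1, one_pos, by simp⟩
    | succ K ih =>
      obtain ⟨d, hd, hd'⟩ := ih
      by_cases hK : A K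
      · have hK0 : (0 : ℝ) < K := by exact_mod_cast hA K hK
        have hK1 : 0 < 1 - f K := sub_pos.2 (hf K hK)
        refine ⟨min d ((1 - f K) / K), by positivity, fun N hN hAN => ?_⟩
        rcases Nat.lt_succ_iff_lt_or_eq.1 hN with hN | rfl
        · exact (hd' N hN hAN).trans (hmono (min_le_left _ _))
        · refine le_trans ?_ (hmono (min_le_right _ _))
          have := Real.add_one_le_exp (-((1 - f N) / N) * N)
          rw [neg_mul, div_mul_cancel₀ _ hK0.ne'] at this ⊢
          linarith
      · refine ⟨d, hd, fun N hN hAN => ?_⟩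
        rcases Nat.lt_succ_iff_lt_or_eq.1 hN with hN | rfl
        · exact hd' N hN hAN
        · exact absurd hAN hK
  obtain ⟨K, hK⟩ := eventually_atTop.1 h
  obtain ⟨d, hd, hd'⟩ := hfin K
  refine ⟨min c d, lt_min hc hd, fun N hAN => ?_⟩
  rcases lt_or_ge N K with hN | hN
  · exact (hd' N hN hAN).trans (hmono (min_le_right _ _))
  · exact (hK N hN).trans (hmono (min_le_left _ _))

/-! ### Transfer to arbitrary probability spaces -/

/-- The weights `x` on the sites with positive coordinates, and `0` on the axes. -/
noncomputable def extendByZero (x : ℕ+ × ℕ+ → ℝ) (y : ℕ × ℕ) : ℝ :=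
  if h : 0 < y.1 ∧ 0 < y.2 then x (⟨y.1, h.1⟩, ⟨y.2, h.2⟩) else 0

theorem extendByZero_coe (x : ℕ+ × ℕ+ → ℝ) (y : ℕ+ × ℕ+) : extendByZero x (y.1, y.2) = x y :=
  dif_pos ⟨y.1.pos, y.2.pos⟩

theorem extendByZero_nonneg {x : ℕ+ × ℕ+ → ℝ} (hx : ∀ y, 0 ≤ x y) (y : ℕ × ℕ) :
    0 ≤ extendByZero x y := by
  unfold extendByZero
  split_ifs
  exacts [hx _, le_rfl]

theorem measurable_extendByZero : Measurable extendByZero := by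
  refine measurable_pi_lambda _ fun y => ?_
  unfold extendByZero
  split_ifs <;> fun_prop

theorem scaledPassage_extendByZero (z : ℕ × ℕ → ℝ) :
    scaledPassage 0 0 (extendByZero fun y => z (y.1, y.2)) = scaledPassage 0 0 z := by
  have : scaleBoundary 0 0 (extendByZero fun y => z (y.1, y.2)) = scaleBoundary 0 0 z := by
    ext ⟨i, j⟩
    rcases i with - | i <;> rcases j with - | j <;> simp [extendByZero]
  ext n m
  rw [scaledPassage, this, scaledPassage]

/-- The deviation probabilities depend only on the law of the weights, so they can be computed in the
model `expField α`, which also carries weights on the axes. -/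
theorem lastPassage_deviation_eq {α : ℝ} (hα : 0 < α) {Ω : Type*} [MeasurableSpace Ω]
    {P : Measure Ω} [IsProbabilityMeasure P] {ξ : ℕ+ × ℕ+ → Ω → ℝ}
    (hξ : ∀ y, HasLaw (ξ y) (expMeasure α) P) (hind : iIndepFun ξ P) {N M : ℕ} (hN : 1 ≤ N)
    (hM : 1 ≤ M) (δ L : ℝ) :
    P.real {ω | δ < |lastPassage (fun y => ξ y ω) N M / N - L|} =
      (expField α).real {z | δ < |scaledPassage 0 0 z N M / N - L|} := by
  have := isProbabilityMeasure_expMeasure hα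
  have hinj : Function.Injective fun y : ℕ+ × ℕ+ => ((y.1 : ℕ), (y.2 : ℕ)) := by
    rintro ⟨a, b⟩ ⟨c, d⟩ h
    simpa using h
  have hlaw : HasLaw (fun ω y => ξ y ω)
      ((expField α).map fun z (y : ℕ+ × ℕ+) => z ((y.1 : ℕ), (y.2 : ℕ))) P := by
    have h := hind.hasLaw_infinitePi hξ
      (aemeasurable_pi_iff.2 fun y => (hξ y).aemeasurable)
    have h2 := Measure.map_infinitePi_infinitePi_of_inj
      (P := fun _ : ℕ × ℕ => expMeasure α) hinj
    rw [expField, h2]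
    exact h
  set B : Set (ℕ+ × ℕ+ → ℝ) := {x | δ < |scaledPassage 0 0 (extendByZero x) N M / N - L|} with hB
  have hBm : MeasurableSet B := by
    have := (measurable_scaledPassage 0 0 N M).comp measurable_extendByZero
    exact measurableSet_lt measurable_const (by fun_prop)
  have hrestr : Measurable fun (z : ℕ × ℕ → ℝ) (y : ℕ+ × ℕ+) => z ((y.1 : ℕ), (y.2 : ℕ)) := by
    fun_prop
  have hnonneg : ∀ᵐ ω ∂P, ∀ y, 0 ≤ ξ y ω := by
    rw [ae_all_iff]
    intro y
    have h := ae_nonneg_expMeasure α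
    rw [← (hξ y).map_eq] at h
    exact ae_of_ae_map (hξ y).aemeasurable h
  have h1 : P.real {ω | δ < |lastPassage (fun y => ξ y ω) N M / N - L|} =
      P.real ((fun ω y => ξ y ω) ⁻¹' B) := by
    refine measureReal_congr ?_
    filter_upwards [hnonneg] with ω hω
    have h := lastPassage_eq_scaledPassage (extendByZero_nonneg hω) hN hM
    simp only [extendByZero_coe] at h
    have h' : lastPassage (fun y => ξ y ω) N M =
      scaledPassage 0 0 (extendByZero fun y => ξ y ω) N M := h
    change (δ < |lastPassage (fun y => ξ y ω) N M / N - L|) =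
      (δ < |scaledPassage 0 0 (extendByZero fun y => ξ y ω) N M / N - L|)
    rw [h']
  have h2 : P.real ((fun ω y => ξ y ω) ⁻¹' B) =
      ((expField α).map fun z (y : ℕ+ × ℕ+) => z ((y.1 : ℕ), (y.2 : ℕ))).real B := by
    rw [← hlaw.map_eq, measureReal_def, measureReal_def,
      Measure.map_apply_of_aemeasurable hlaw.aemeasurable hBm]
  rw [h1, h2, map_measureReal_apply hrestr hBm]
  simp only [hB, Set.preimage_ofPred_eq, scaledPassage_extendByZero]

theorem exists_deviation_rate {α β δ : ℝ} (hα : 0 < α) (hβ : 0 < β) (hδ : 0 < δ) :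
    ∃ c : ℝ, 0 < c ∧ ∀ N : ℕ, 1 ≤ ⌊β * N⌋₊ →
      (expField α).real {z | δ < |scaledPassage 0 0 z N ⌊β * N⌋₊ / N - (1 + √β) ^ 2 / α|} ≤
        Real.exp (-c * N) := by
  have hm : Tendsto (fun N : ℕ => ((⌊β * N⌋₊ : ℕ) : ℝ) / N) atTop (𝓝 (√β ^ 2)) := by
    rw [Real.sq_sqrt hβ.le]
    exact (tendsto_nat_floor_mul_div_atTop hβ.le).comp tendsto_natCast_atTop_atTop
  have hpos : ∀ N : ℕ, 1 ≤ ⌊β * N⌋₊ → 0 < N := by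
    rintro N h
    rcases Nat.eq_zero_or_pos N with rfl | hN
    · simp at h
    · exact hN
  obtain ⟨c, hc, h⟩ := concentratesAt_scaledPassage_zero hα (Real.sqrt_pos.2 hβ) hm δ hδ
  exact exists_exp_bound_of_eventually hc h hpos fun N hN =>
    expField_deviation_lt_one hα (by positivity) hδ (hpos N hN) hN

/-- By the Borel–Cantelli lemma; the `Y N` need not be measurable. -/
theorem ConcentratesAt.ae_tendsto {Ω : Type*} [MeasurableSpace Ω] {μ : Measure Ω}
    [IsFiniteMeasure μ] {Y : ℕ → Ω → ℝ} {ℓ : ℝ} (h : ConcentratesAt μ Y ℓ) :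
    ∀ᵐ ω ∂μ, Tendsto (fun N => Y N ω / N) atTop (𝓝 ℓ) := by
  have hev : ∀ k : ℕ, ∀ᵐ ω ∂μ, ∀ᶠ N in atTop,
      ω ∉ {ω | 1 / ((k : ℝ) + 1) < |Y N ω / N - ℓ|} := by
    intro k
    obtain ⟨c, hc, hE⟩ := h (1 / ((k : ℝ) + 1)) (by positivity)
    refine ae_eventually_notMem ?_
    have hsum : Summable fun N : ℕ => μ.real {ω | 1 / ((k : ℝ) + 1) < |Y N ω / N - ℓ|} := by
      have hg : Summable fun N : ℕ => Real.exp (-c * N) := by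
        simp only [mul_comm (-c)]
        exact Real.summable_exp_nat_mul_iff.2 (by linarith)
      refine Summable.of_norm_bounded_eventually_nat hg (hE.mono fun N hN => ?_)
      rwa [Real.norm_of_nonneg measureReal_nonneg]
    have := hsum.tsum_ofReal_ne_top
    simpa [ofReal_measureReal] using this
  filter_upwards [ae_all_iff.2 hev] with ω hω
  rw [Metric.tendsto_nhds]
  intro ε hε
  obtain ⟨k, hk⟩ := exists_nat_one_div_lt hε
  filter_upwards [hω k] with N hN
  rw [Real.dist_eq]
  exact (not_lt.1 hN).trans_lt hk

theorem mainTheorem6 (α β : ℝ) (hα : 0 < α) (hβ : 0 < β) :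
    ∃ c : ℝ → ℝ, (∀ δ : ℝ, 0 < δ → 0 < c δ) ∧
      ∀ (Ω : Type*) [MeasurableSpace Ω] (P : Measure Ω) [IsProbabilityMeasure P]
        (ξ : ℕ+ × ℕ+ → Ω → ℝ),
        (∀ y, HasLaw (ξ y) (expMeasure α) P) → iIndepFun ξ P →
        (∀ᵐ ω ∂P, Tendsto
          (fun N : ℕ => lastPassage (fun y => ξ y ω) N ⌊β * N⌋₊ / N)
          atTop (𝓝 ((1 + √β) ^ 2 / α))) ∧
        ∀ δ : ℝ, 0 < δ → ∀ N : ℕ, 1 ≤ ⌊β * N⌋₊ →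
          P.real {ω | δ < |lastPassage (fun y => ξ y ω) N ⌊β * N⌋₊ / N - (1 + √β) ^ 2 / α|}
            ≤ Real.exp (-(c δ) * N) := by
  have hc : ∀ δ : ℝ, ∃ c : ℝ, 0 < δ → 0 < c ∧ ∀ N : ℕ, 1 ≤ ⌊β * N⌋₊ →
      (expField α).real {z | δ < |scaledPassage 0 0 z N ⌊β * N⌋₊ / N - (1 + √β) ^ 2 / α|} ≤
        Real.exp (-c * N) := by
    intro δ
    by_cases hδ : 0 < δ
    · obtain ⟨c, hc⟩ := exists_deviation_rate hα hβ hδ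
      exact ⟨c, fun _ => hc⟩
    · exact ⟨0, fun h => absurd h hδ⟩
  choose c hc using hc
  refine ⟨c, fun δ hδ => (hc δ hδ).1, fun Ω _ P _ ξ hξ hind => ?_⟩
  have hbound : ∀ δ : ℝ, 0 < δ → ∀ N : ℕ, 1 ≤ ⌊β * N⌋₊ →
      P.real {ω | δ < |lastPassage (fun y => ξ y ω) N ⌊β * N⌋₊ / N - (1 + √β) ^ 2 / α|}
        ≤ Real.exp (-(c δ) * N) := by
    intro δ hδ N hM
    have hN : 1 ≤ N := by
      rcases Nat.eq_zero_or_pos N with rfl | hN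
      · simp at hM
      · exact hN
    rw [lastPassage_deviation_eq hα hξ hind hN hM]
    exact (hc δ hδ).2 N hM
  refine ⟨ConcentratesAt.ae_tendsto fun δ hδ => ⟨c δ, (hc δ hδ).1, ?_⟩, hbound⟩
  have hfloor : Tendsto (fun N : ℕ => ⌊β * N⌋₊) atTop atTop :=
    tendsto_nat_floor_atTop.comp (tendsto_natCast_atTop_atTop.const_mul_atTop hβ)
  filter_upwards [hfloor.eventually_ge_atTop 1] with N hN
  exact hbound δ hδ N hN
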